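/- **Setting.** There are $J$ zones, assigned to $R$ study regions by $j\mapsto r(j)$; the number $K\ge 1$ of folds is fixed. At stage $m=1,2,\dots$ zone $j$ has $n_j=n_j(m)$ labeled fields $(Y_{ji},V_{ji},X_{ji})$, $i\le n_j$, and $N_j=N_j(m)$ unlabeled fields $(V_{ji},X_{ji})$, $n_j<i\le n_j+N_j$; here $Y_{ji}\in\mathbb R$ is a yield, $V_{ji}$ a photo (an element of a measurable space) and $X_{ji}\in\mathbb R^p$ a covariate vector. The estimator is computed as follows. 1. *Cross-fitting.* The labeled fields of each zone are split into $K$ folds whose sizes differ by at most one. For each $k$ a photo model $\hat g^{(-k)}$ is trained, by any measurable and possibly randomized procedure, on the labeled fields of all zones outside fold $k$. Put $\hat Y_{ji}=\hat g^{(-k)}(V_{ji})$ for a labeled field in fold $k$, and $\hat Y_{ji}=\frac1K\sum_k\hat g^{(-k)}(V_{ji})$ for an unlabeled field. The split and the training may use auxiliary randomness that is independent of all data. 2. *Control function.* For each region $r$, $\hat\beta_r\in\mathbb R^{p+2}$ is a LASSO coefficient vector (with unpenalized intercept, with or without standardization of the features) for predicting $Y_{ji}$ from $(1,\hat Y_{ji},X_{ji})$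 on all labeled fields of the region, with any nonnegative, possibly random and data-dependent penalty level (for instance chosen by 5-fold cross-validation). Put $f_{ji}=(1,\hat Y_{ji},X_{ji})\hat\beta_{r(j)}$. 3. *PPI++.* For each zone put $$\hat\lambda_j=\frac{N_j}{n_j+N_j}\cdot\frac{\frac1{n_j-1}\sum_{i\le n_j}(Y_{ji}-\bar Y_j)(f_{ji}-\bar f_{n,j})}{\frac1{n_j+N_j-1}\sum_{i\le n_j+N_j}(f_{ji}-\bar f_j)^2},\qquad \hat\theta_{\mathrm{PPI++},j}=\bar Y_j-\hat\lambda_j\Big(\bar f_{n,j}-\frac1{N_j}\sum_{i=n_j+1}^{n_j+N_j}f_{ji}\Big),$$ where $\bar Y_j,\bar f_{n,j}$ are the averages over the $n_j$ labeled fields and $\bar f_j$ is the average over all $n_j+N_j$ fields of zone $j$. **Assumptions.** At each stage, for every zone $j$, the labeled fields are i.i.d. with a law $P_j$ that does not depend on the stage, and the unlabeled fields are i.i.d. with the law of $(V,X)$ under $P_j$; labeled fields of different zones are independent, and all labeled fields are jointly independent of all unlabeled fields. As $m\to\infty$, $N_j\to\infty$ and $n_j/N_j\to\rho_j\in(0,\infty)$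 for every $j$. Under every $P_j$, $\mathbb E[Y^2]<\infty$ and $\mathbb E\|X\|_2^2<\infty$. There is a measurable $g$ with $\mathbb E_{P_j}[g(V)^2]<\infty$ such that for all $j,k$ the mean squared error $\int(\hat g^{(-k)}(v)-g(v))^2\,dP_j$, a random variable through $\hat g^{(-k)}$, converges to $0$ in probability (this holds in particular if its expectation tends to $0$). Finally $\hat\beta_{r(j)}\to\beta_{r(j)}$ in probability for every $j$, where $\beta_{r(j)}$ is nonrandom. **Theorem.** Let $\theta_j=\mathbb E_{P_j}[Y]$ and $f_j^*=(1,g(V),X)\beta_{r(j)}$. For every zone $j$ with $\mathrm{Var}_{P_j}(f_j^*)>0$ put $$\lambda_j=\frac{\mathrm{cov}_{P_j}(Y,f_j^*)}{(1+\rho_j)\mathrm{Var}_{P_j}(f_j^*)},\qquad V_j=\rho_j\lambda_j^2\,\mathrm{Var}_{P_j}(f_j^*)+\mathrm{Var}_{P_j}(Y-\lambda_jf_j^*).$$ Then, as $m\to\infty$, $$\sqrt{n_j}\,(\hat\theta_{\mathrm{PPI++},j}-\theta_j)\xrightarrow{d}\mathcal N(0,V_j),\qquad \hat\lambda_j\xrightarrow{p}\lambda_j,$$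 and $\hat\theta_{\mathrm{PPI++},j}$ is asymptotically equivalent to the oracle estimator $$\hat\theta^*_{\mathrm{PPI++},j}=\bar Y_j-\lambda_j\Big(\frac1{n_j}\sum_{i\le n_j}f_j^*(V_{ji},X_{ji})-\frac1{N_j}\sum_{i=n_j+1}^{n_j+N_j}f_j^*(V_{ji},X_{ji})\Big),$$ that is, $\sqrt{n_j}\,(\hat\theta_{\mathrm{PPI++},j}-\hat\theta^*_{\mathrm{PPI++},j})\to0$ in probability. -/

import Mathlib

open MeasureTheory ProbabilityTheory Filter Topology

namespace PPI

/-- A labeled field `(Y, V, X)`: ground truth yield, photo, covariate vector in `ℝ^p`. -/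
abbrev Labeled (𝒱 : Type*) (p : ℕ) := ℝ × 𝒱 × EuclideanSpace ℝ (Fin p)

/-- An unlabeled field `(V, X)`. -/
abbrev Unlabeled (𝒱 : Type*) (p : ℕ) := 𝒱 × EuclideanSpace ℝ (Fin p)

/-- Coefficient and feature vectors `(constant, photo prediction, covariates)`. -/
abbrev Coef (p : ℕ) := EuclideanSpace ℝ (Fin (p + 2))

noncomputable section

/-! ### The PPI++ estimator

The control function enters only through its values `fL` on the labeled fields and `fU` on the
unlabeled fields; `y` are the labels. -/

/-- `n⁻¹ ∑ aᵢ`. -/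
def sampleMean {n : ℕ} (a : Fin n → ℝ) : ℝ := (∑ i, a i) / (n : ℝ)

/-- Mean over the labeled and the unlabeled fields together. -/
def pooledMean {n N : ℕ} (fL : Fin n → ℝ) (fU : Fin N → ℝ) : ℝ :=
  ((∑ i, fL i) + ∑ i, fU i) / ((n : ℝ) + (N : ℝ))

/-- Sample covariance of labels and control function over the labeled fields. -/
def sampleCov {n : ℕ} (y fL : Fin n → ℝ) : ℝ :=
  (∑ i, (y i - sampleMean y) * (fL i - sampleMean fL)) / ((n : ℝ) - 1)

/-- Sample variance of the control function over all fields. -/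
def pooledVar {n N : ℕ} (fL : Fin n → ℝ) (fU : Fin N → ℝ) : ℝ :=
  ((∑ i, (fL i - pooledMean fL fU) ^ 2) + ∑ i, (fU i - pooledMean fL fU) ^ 2) /
    ((n : ℝ) + (N : ℝ) - 1)

/-- The data-driven PPI++ coefficient. -/
def lambdaHat {n N : ℕ} (y fL : Fin n → ℝ) (fU : Fin N → ℝ) : ℝ :=
  (N : ℝ) / ((n : ℝ) + (N : ℝ)) * (sampleCov y fL / pooledVar fL fU)

/-- `mean(y) - l * (mean(fL) - mean(fU))`: the estimator with a given coefficient `l`. -/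
def ppiWith {n N : ℕ} (l : ℝ) (y fL : Fin n → ℝ) (fU : Fin N → ℝ) : ℝ :=
  sampleMean y - l * (sampleMean fL - sampleMean fU)

/-- The PPI++ estimator. -/
def ppiPlusPlus {n N : ℕ} (y fL : Fin n → ℝ) (fU : Fin N → ℝ) : ℝ :=
  ppiWith (lambdaHat y fL fU) y fL fU

/-! ### Linear control functions and the LASSO -/

/-- The feature vector `(1, ŷ, x)`. -/
def feature {p : ℕ} (yhat : ℝ) (x : EuclideanSpace ℝ (Fin p)) : Coef p :=
  WithLp.toLp 2 (Matrix.vecCons 1 (Matrix.vecCons yhat fun c => x c))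

/-- `bᵀ z`. -/
def linPred {p : ℕ} (b z : Coef p) : ℝ := ∑ c, b c * z c

/-- Empirical standard deviation of coordinate `c` of the features `z`. -/
def featureSD {ι : Type*} [Fintype ι] {p : ℕ} (z : ι → Coef p) (c : Fin (p + 2)) : ℝ :=
  √((∑ i, (z i c - (∑ i', z i' c) / (Fintype.card ι : ℝ)) ^ 2) / (Fintype.card ι : ℝ))

/-- The LASSO objective with penalty level `μ` and unpenalized intercept (coordinate `0`).
If `std` is true, coordinates are penalized on the scale of standardized features. -/
def lassoObjective {ι : Type*} [Fintype ι] {p : ℕ} (std : Bool) (μ : ℝ)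
    (y : ι → ℝ) (z : ι → Coef p) (b : Coef p) : ℝ :=
  (∑ i, (y i - linPred b (z i)) ^ 2) / (2 * (Fintype.card ι : ℝ)) +
    μ * ∑ c : Fin (p + 1), (if std then featureSD z c.succ else 1) * |b c.succ|

/-- `b` is a LASSO coefficient vector with penalty level `μ`. -/
def IsLasso {ι : Type*} [Fintype ι] {p : ℕ} (std : Bool) (μ : ℝ)
    (y : ι → ℝ) (z : ι → Coef p) (b : Coef p) : Prop :=
  IsMinOn (lassoObjective std μ y z) Set.univ b

/-! ### The full procedure -/

/-- The random inputs and the tuning choices of one run of the full procedure, with `J` zones,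
`R` study regions and `K` cross-fitting folds. The auxiliary random element `aux` carries the
randomness of the fold assignment and of the training algorithm. -/
structure Run (J R K p : ℕ) (𝒱 𝒰 Ω : Type*) where
  /-- number of labeled fields in each zone -/
  n : Fin J → ℕ
  /-- number of unlabeled fields in each zone -/
  N : Fin J → ℕ
  /-- the labeled fields -/
  lab : (j : Fin J) → Fin (n j) → Ω → Labeled 𝒱 p
  /-- the unlabeled fields -/
  unl : (j : Fin J) → Fin (N j) → Ω → Unlabeled 𝒱 p
  /-- auxiliary randomness -/
  aux : Ω → 𝒰
  /-- assignment of the labeled fields to folds -/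
  fold : 𝒰 → (j : Fin J) → Fin (n j) → Fin K
  /-- `train k u d` is the photo model produced for fold `k` from the labeled data `d` -/
  train : Fin K → 𝒰 → ((j : Fin J) → Fin (n j) → Labeled 𝒱 p) → 𝒱 → ℝ
  /-- study region of each zone -/
  region : Fin J → Fin R
  /-- whether the LASSO standardizes the features -/
  std : Bool
  /-- LASSO penalty levels, which may depend on the data (for instance by cross-validation) -/
  penalty : Fin R → Ω → ℝ
  /-- the fitted coefficients of each study region -/
  betaHat : Fin R → Ω → Coef p

namespace Run

variable {J R K p : ℕ} {𝒱 𝒰 Ω : Type*} (S : Run J R K p 𝒱 𝒰 Ω)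

/-- All labeled data. -/
def labData (ω : Ω) : (j : Fin J) → Fin (S.n j) → Labeled 𝒱 p := fun j i => S.lab j i ω

/-- All unlabeled data. -/
def unlData (ω : Ω) : (j : Fin J) → Fin (S.N j) → Unlabeled 𝒱 p := fun j i => S.unl j i ω

/-- The photo model of fold `k`. -/
def ghat (k : Fin K) (ω : Ω) : 𝒱 → ℝ := S.train k (S.aux ω) (S.labData ω)

/-- Labels in zone `j`. -/
def y (j : Fin J) (ω : Ω) (i : Fin (S.n j)) : ℝ := (S.lab j i ω).1

/-- Photo prediction on a labeled field: the model of its own fold. -/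
def yhatLab (j : Fin J) (ω : Ω) (i : Fin (S.n j)) : ℝ :=
  S.ghat (S.fold (S.aux ω) j i) ω (S.lab j i ω).2.1

/-- Photo prediction on an unlabeled field: the average of the `K` models. -/
def yhatUnl (j : Fin J) (ω : Ω) (i : Fin (S.N j)) : ℝ :=
  (∑ k, S.ghat k ω (S.unl j i ω).1) / (K : ℝ)

/-- Features of a labeled field. -/
def featLab (j : Fin J) (ω : Ω) (i : Fin (S.n j)) : Coef p :=
  feature (S.yhatLab j ω i) (S.lab j i ω).2.2

/-- Features of an unlabeled field. -/
def featUnl (j : Fin J) (ω : Ω) (i : Fin (S.N j)) : Coef p :=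
  feature (S.yhatUnl j ω i) (S.unl j i ω).2

/-- The learned control function on the labeled fields of zone `j`. -/
def fLab (j : Fin J) (ω : Ω) (i : Fin (S.n j)) : ℝ :=
  linPred (S.betaHat (S.region j) ω) (S.featLab j ω i)

/-- The learned control function on the unlabeled fields of zone `j`. -/
def fUnl (j : Fin J) (ω : Ω) (i : Fin (S.N j)) : ℝ :=
  linPred (S.betaHat (S.region j) ω) (S.featUnl j ω i)

/-- The coefficient `λ̂ⱼ` of zone `j`. -/
def lambda (j : Fin J) (ω : Ω) : ℝ := lambdaHat (S.y j ω) (S.fLab j ω) (S.fUnl j ω)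

/-- The PPI++ estimate of zone `j`. -/
def estimate (j : Fin J) (ω : Ω) : ℝ := ppiPlusPlus (S.y j ω) (S.fLab j ω) (S.fUnl j ω)

/-- The oracle estimate of zone `j`, with a fixed control function `f` and coefficient `l`. -/
def oracle (f : Unlabeled 𝒱 p → ℝ) (l : ℝ) (j : Fin J) (ω : Ω) : ℝ :=
  ppiWith l (S.y j ω) (fun i => f (S.lab j i ω).2) (fun i => f (S.unl j i ω))

/-- The labeled fields whose zone lies in region `r`. -/
abbrev RegionIndex (r : Fin R) := {a : Σ j : Fin J, Fin (S.n j) // S.region a.1 = r}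

/-- The rules that a run of the procedure obeys. -/
structure IsValid [MeasurableSpace 𝒱] [MeasurableSpace 𝒰] [MeasurableSpace Ω] : Prop where
  measurable_fold : ∀ j i, Measurable fun u => S.fold u j i
  /-- the folds of each zone are as even as possible -/
  fold_even : ∀ u j k k', (Finset.univ.filter fun i => S.fold u j i = k).card ≤
    (Finset.univ.filter fun i => S.fold u j i = k').card + 1
  measurable_train : ∀ k, Measurable fun q : 𝒰 × ((j : Fin J) → Fin (S.n j) → Labeled 𝒱 p) × 𝒱 =>
    S.train k q.1 q.2.1 q.2.2
  /-- the model of fold `k` uses only the labeled fields outside fold `k` -/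
  train_outside_fold : ∀ k u d d', (∀ j i, S.fold u j i ≠ k → d j i = d' j i) →
    S.train k u d = S.train k u d'
  measurable_betaHat : ∀ r, Measurable (S.betaHat r)
  penalty_nonneg : ∀ r ω, 0 ≤ S.penalty r ω
  /-- regional coefficients are LASSO fits on all labeled fields of the region -/
  lasso : ∀ r ω, IsLasso S.std (S.penalty r ω)
    (fun a : S.RegionIndex r => S.y a.1.1 ω a.1.2)
    (fun a : S.RegionIndex r => S.featLab a.1.1 ω a.1.2) (S.betaHat r ω)

/-- The sampling assumptions: in zone `j` the labeled fields are i.i.d. with law `P j`, the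
unlabeled ones are i.i.d. with the corresponding law of `(V, X)`, the labeled fields are independent
across zones, they are independent of the unlabeled fields, and the auxiliary randomness is
independent of all data. -/
structure IsSample [MeasurableSpace 𝒱] [MeasurableSpace 𝒰] [MeasurableSpace Ω]
    (P : Fin J → Measure (Labeled 𝒱 p)) (Pr : Measure Ω) : Prop where
  measurable_lab : ∀ j i, Measurable (S.lab j i)
  measurable_unl : ∀ j i, Measurable (S.unl j i)
  measurable_aux : Measurable S.aux
  law_lab : ∀ j i, Pr.map (S.lab j i) = P j
  law_unl : ∀ j i, Pr.map (S.unl j i) = (P j).map Prod.snd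
  indep_lab : iIndepFun (fun (a : Σ j : Fin J, Fin (S.n j)) => S.lab a.1 a.2) Pr
  indep_unl : ∀ j, iIndepFun (fun i : Fin (S.N j) => S.unl j i) Pr
  indep_lab_unl : IndepFun S.labData S.unlData Pr
  indep_aux : IndepFun S.aux (fun ω => (S.labData ω, S.unlData ω)) Pr

end Run

/-! ### Limiting quantities, in terms of the law `P` of a labeled field -/

/-- The limiting control function `f*(v, x) = (1, g(v), x) β`. -/
def fStar {𝒱 : Type*} {p : ℕ} (g : 𝒱 → ℝ) (β : Coef p) (w : Unlabeled 𝒱 p) : ℝ :=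
  linPred β (feature (g w.1) w.2)

variable {𝒱 : Type*} {p : ℕ} [MeasurableSpace 𝒱]

/-- `θ = E[Y]`. -/
def theta (P : Measure (Labeled 𝒱 p)) : ℝ := ∫ z, z.1 ∂P

/-- `Var(f(V, X))`. -/
def varControl (P : Measure (Labeled 𝒱 p)) (f : Unlabeled 𝒱 p → ℝ) : ℝ :=
  variance (fun z => f z.2) P

/-- `λ = cov(Y, f) / ((1 + ρ) Var f)`. -/
def lambdaStar (P : Measure (Labeled 𝒱 p)) (f : Unlabeled 𝒱 p → ℝ) (ρ : ℝ) : ℝ :=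
  covariance (fun z => z.1) (fun z => f z.2) P / ((1 + ρ) * varControl P f)

/-- `ρ λ² Var f + Var(Y - λ f)`. -/
def asympVar (P : Measure (Labeled 𝒱 p)) (f : Unlabeled 𝒱 p → ℝ) (ρ : ℝ) : ℝ :=
  ρ * lambdaStar P f ρ ^ 2 * varControl P f +
    variance (fun z => z.1 - lambdaStar P f ρ * f z.2) P

end

end PPI

/-! Let `f` be the learned control function and `f*` its limit. Conditionally on the training data,
a photo model evaluated at held-out fields and centered at its conditional mean gives orthogonal
terms, so the normalized sums of these terms have second moments bounded by the squared `L²`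
distance between the photo model and `g`, and vanish in the limit. What remains is the mean error
of each photo model. Every fold holds a share `1/K` of the labeled fields up to at most one field,
and unlabeled predictions average the `K` models, so these mean errors cancel from the difference
between the labeled and the unlabeled mean of `f`; hence `√n_j` times that difference may be
computed with `f*` in place of `f`. The coefficient `λ̂_j` only involves second moments of the
sample, so it suffices for its consistency that `f` is close to `f*` in empirical mean square. The
estimator is thus equivalent to the oracle, which is a difference of two independent sample means
to which the central limit theorem applies. -/

namespace PPI

/-! ### Convergence and boundedness in probability -/

lemma tendsto_zero_of_sq {α : Type*} {F : Filter α} {X : α → ℝ}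
    (h : Tendsto (fun q => X q ^ 2) F (𝓝 0)) : Tendsto X F (𝓝 0) := by
  rw [tendsto_zero_iff_abs_tendsto_zero]
  simpa [Function.comp_def, Real.sqrt_sq_eq_abs] using h.sqrt

section InProb

variable {Ω : Type*} [MeasurableSpace Ω] {Pr : Measure Ω}

/-- The filter of those sets of pairs `(m, ω)` whose `m`-th section has probability tending to one
as `m → ∞`. Convergence in probability to a constant is convergence along this filter, so that
deterministic limit theorems along filters apply to it. -/
def inProb (Pr : Measure Ω) : Filter (ℕ × Ω) where
  sets := {A | Tendsto (fun m => Pr {ω | (m, ω) ∉ A}) atTop (𝓝 0)}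
  univ_sets := by simp
  sets_of_superset := fun hA hAB =>
    tendsto_of_tendsto_of_tendsto_of_le_of_le tendsto_const_nhds hA (fun _ => zero_le)
      (fun _ => measure_mono fun _ hω h => hω (hAB h))
  inter_sets := fun {A B} hA hB => by
    have h := Tendsto.add hA hB
    rw [add_zero] at h
    refine tendsto_of_tendsto_of_tendsto_of_le_of_le tendsto_const_nhds h (fun _ => zero_le)
      (fun m => (measure_mono fun ω hω => ?_).trans (measure_union_le _ _))
    by_contra hc
    simp only [Set.mem_union, Set.mem_ofPred_eq, not_or, not_not] at hc
    exact hω hc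

lemma eventually_inProb {p : ℕ × Ω → Prop} :
    (∀ᶠ q in inProb Pr, p q) ↔ Tendsto (fun m => Pr {ω | ¬ p (m, ω)}) atTop (𝓝 0) := Iff.rfl

lemma tendsto_fst_inProb : Tendsto Prod.fst (inProb Pr) atTop := fun A hA =>
  eventually_inProb.2 <| tendsto_const_nhds.congr' <| by
    filter_upwards [hA] with m hm
    simp [hm]

lemma tendstoInMeasure_const_iff {E : Type*} [PseudoMetricSpace E] {X : ℕ → Ω → E} {c : E} :
    TendstoInMeasure Pr X atTop (fun _ => c) ↔
      Tendsto (fun q : ℕ × Ω => X q.1 q.2) (inProb Pr) (𝓝 c) := by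
  rw [tendstoInMeasure_iff_dist, Metric.tendsto_nhds]
  simp_rw [eventually_inProb, not_lt]

lemma tendsto_zero_inProb_iff {X : ℕ → Ω → ENNReal} :
    Tendsto (fun q : ℕ × Ω => X q.1 q.2) (inProb Pr) (𝓝 0) ↔
      ∀ ε, 0 < ε → Tendsto (fun m => Pr {ω | ε ≤ X m ω}) atTop (𝓝 0) := by
  simp [ENNReal.nhds_zero_basis.tendsto_right_iff, eventually_inProb]

/-- Boundedness of `X` along a filter up to events that the filter neglects, `X = O_P(1)` in the
case of `inProb`, expressed through its effect on sequences tending to zero. -/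
def BddAlong {α : Type*} (F : Filter α) (X : α → ℝ) : Prop :=
  ∀ T : α → ℝ, Tendsto T F (𝓝 0) → Tendsto (fun q => T q * X q) F (𝓝 0)

lemma BddAlong.sub {α : Type*} {F : Filter α} {X Y : α → ℝ} (hX : BddAlong F X)
    (hY : BddAlong F Y) : BddAlong F (fun q => X q - Y q) := fun T hT => by
  simpa [mul_sub] using (hX T hT).sub (hY T hT)

lemma BddAlong.mul_of_tendsto {α : Type*} {F : Filter α} {X Y : α → ℝ} {c : ℝ}
    (hX : BddAlong F X) (hY : Tendsto Y F (𝓝 c)) : BddAlong F (fun q => Y q * X q) :=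
  fun T hT => by
  simpa [mul_assoc] using hX (fun q => T q * Y q) (by simpa using hT.mul hY)

lemma bddAlong_inProb_of_tight {X : ℕ → Ω → ℝ}
    (h : ∀ δ : ENNReal, 0 < δ → ∃ M : ℝ, 0 < M ∧ ∀ᶠ m in atTop, Pr {ω | M ≤ |X m ω|} ≤ δ) :
    BddAlong (inProb Pr) fun q => X q.1 q.2 := by
  intro T hT
  rw [Metric.tendsto_nhds]
  intro a ha
  rw [eventually_inProb, ENNReal.tendsto_nhds_zero]
  intro δ hδ
  have hδ2 := ENNReal.half_pos hδ.ne'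
  obtain ⟨M, hM0, hM⟩ := h (δ / 2) hδ2
  have hTM := Metric.tendsto_nhds.1 hT (a / M) (by positivity)
  rw [eventually_inProb, ENNReal.tendsto_nhds_zero] at hTM
  filter_upwards [hM, hTM (δ / 2) hδ2] with m hXm hTm
  have hsub : {ω | ¬ dist (T (m, ω) * X m ω) 0 < a} ⊆
      {ω | M ≤ |X m ω|} ∪ {ω | ¬ dist (T (m, ω)) 0 < a / M} := by
    intro ω
    contrapose!
    simp only [Set.mem_union, Set.mem_ofPred_eq, not_or, not_le, dist_zero_right,
      Real.norm_eq_abs, abs_mul, lt_div_iff₀ hM0]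
    intro ⟨hX, hT⟩
    exact (mul_le_mul_of_nonneg_left hX.le (abs_nonneg _)).trans_lt hT
  calc Pr {ω | ¬ dist (T (m, ω) * X m ω) 0 < a}
      ≤ _ := (measure_mono hsub).trans (measure_union_le _ _)
    _ ≤ δ / 2 + δ / 2 := add_le_add hXm hTm
    _ = δ := ENNReal.add_halves δ

lemma bddAlong_sub_integral_of_variance_le [IsFiniteMeasure Pr] {X : ℕ → Ω → ℝ} {C : ℝ}
    (hX : ∀ m, MemLp (X m) 2 Pr) (hC : ∀ m, variance (X m) Pr ≤ C) :
    BddAlong (inProb Pr) fun q => X q.1 q.2 - ∫ ω, X q.1 ω ∂Pr := by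
  refine bddAlong_inProb_of_tight (X := fun m ω => X m ω - ∫ ω, X m ω ∂Pr) fun δ hδ => ?_
  have hlim : Tendsto (fun M : ℝ => ENNReal.ofReal (C / M ^ 2)) atTop (𝓝 0) := by
    rw [← ENNReal.ofReal_zero]
    exact ENNReal.tendsto_ofReal
      (tendsto_const_nhds.div_atTop (tendsto_pow_atTop two_ne_zero))
  obtain ⟨M, hM, hM0⟩ :=
    ((ENNReal.tendsto_nhds_zero.1 hlim δ hδ).and (eventually_gt_atTop 0)).exists
  refine ⟨M, hM0, .of_forall fun m => ?_⟩
  calc Pr {ω | M ≤ |X m ω - ∫ ω, X m ω ∂Pr|}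
      ≤ ENNReal.ofReal (variance (X m) Pr / M ^ 2) := meas_ge_le_variance_div_sq (hX m) hM0
    _ ≤ ENNReal.ofReal (C / M ^ 2) := ENNReal.ofReal_le_ofReal (by gcongr; exact hC m)
    _ ≤ δ := hM

/-- `X` is integrable with integral at most `c` up to a modification where the random bound `M`
exceeds `c`, for every level `c`. This replaces a moment bound conditional on a fitted model when
the conditional moment `M` need not be integrable. -/
def ControlledBy (Pr : Measure Ω) (X : Ω → ℝ) (M : Ω → ENNReal) : Prop :=
  ∀ c : NNReal, ∃ X' : Ω → ℝ, AEMeasurable X' Pr ∧ ∫⁻ ω, ‖X' ω‖ₑ ∂Pr ≤ c ∧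
    ∀ ω, M ω ≤ c → X ω = X' ω

lemma tendsto_zero_of_controlledBy {X : ℕ → Ω → ℝ} {M : ℕ → Ω → ENNReal}
    (hXM : ∀ m, ControlledBy Pr (X m) (M m))
    (hM : Tendsto (fun q : ℕ × Ω => M q.1 q.2) (inProb Pr) (𝓝 0)) :
    Tendsto (fun q : ℕ × Ω => X q.1 q.2) (inProb Pr) (𝓝 0) := by
  rw [tendsto_zero_iff_enorm_tendsto_zero, ENNReal.tendsto_nhds_zero]
  intro a ha
  rw [eventually_inProb, ENNReal.tendsto_nhds_zero]
  intro δ hδ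
  have hδ2 := ENNReal.half_pos hδ.ne'
  obtain ⟨c, hc0, hca⟩ := ENNReal.lt_iff_exists_nnreal_btwn.1 (ENNReal.mul_pos ha.ne' hδ2.ne')
  have hMc := ENNReal.tendsto_nhds_zero.1 hM c hc0
  rw [eventually_inProb, ENNReal.tendsto_nhds_zero] at hMc
  filter_upwards [hMc (δ / 2) hδ2] with m hm
  obtain ⟨X', hX', hint, heq⟩ := hXM m c
  have hsub : {ω | ¬ ‖X m ω‖ₑ ≤ a} ⊆ {ω | a ≤ ‖X' ω‖ₑ} ∪ {ω | ¬ M m ω ≤ c} := by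
    intro ω hω
    by_cases h : M m ω ≤ c
    · exact Or.inl (show a ≤ ‖X' ω‖ₑ from heq ω h ▸ (not_le.1 hω).le)
    · exact Or.inr h
  have hmarkov : Pr {ω | a ≤ ‖X' ω‖ₑ} ≤ δ / 2 := by
    by_contra! hlt
    have := (mul_meas_ge_le_lintegral₀ hX'.enorm a).trans hint
    exact (hca.trans_le (mul_le_mul_right hlt.le a)).not_ge this
  calc Pr {ω | ¬ ‖X m ω‖ₑ ≤ a}
      ≤ _ := (measure_mono hsub).trans (measure_union_le _ _)
    _ ≤ δ / 2 + δ / 2 := add_le_add hmarkov hm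
    _ = δ := ENNReal.add_halves δ

end InProb

/-! ### Integrals over independent pairs and orthogonal sums -/

section Independence

variable {Ω 𝒲 𝒵 : Type*} [MeasurableSpace Ω] [MeasurableSpace 𝒲] [MeasurableSpace 𝒵]
  {Pr : Measure Ω} [IsProbabilityMeasure Pr] {W : Ω → 𝒲} {Z : Ω → 𝒵}

lemma lintegral_comp_le_of_indepFun (hW : Measurable W) (hZ : Measurable Z)
    (hWZ : IndepFun W Z Pr) {φ : 𝒲 × 𝒵 → ENNReal} (hφ : Measurable φ) {c : ENNReal}
    (hc : ∀ w, ∫⁻ z, φ (w, z) ∂(Pr.map Z) ≤ c) : ∫⁻ ω, φ (W ω, Z ω) ∂Pr ≤ c := by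
  have : IsProbabilityMeasure (Pr.map Z) := Measure.isProbabilityMeasure_map hZ.aemeasurable
  have : IsProbabilityMeasure (Pr.map W) := Measure.isProbabilityMeasure_map hW.aemeasurable
  calc ∫⁻ ω, φ (W ω, Z ω) ∂Pr = ∫⁻ q, φ q ∂((Pr.map W).prod (Pr.map Z)) := by
        rw [← (indepFun_iff_map_prod_eq_prod_map_map hW.aemeasurable hZ.aemeasurable).1 hWZ,
          lintegral_map hφ (hW.prodMk hZ)]
    _ = ∫⁻ w, ∫⁻ z, φ (w, z) ∂(Pr.map Z) ∂(Pr.map W) := lintegral_prod _ hφ.aemeasurable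
    _ ≤ ∫⁻ _, c ∂(Pr.map W) := lintegral_mono hc
    _ = c := by simp

lemma integral_comp_eq_zero_of_indepFun (hW : Measurable W) (hZ : Measurable Z)
    (hWZ : IndepFun W Z Pr) {φ : 𝒲 × 𝒵 → ℝ} (hφ : Measurable φ)
    (h0 : ∀ w, ∫ z, φ (w, z) ∂(Pr.map Z) = 0) : ∫ ω, φ (W ω, Z ω) ∂Pr = 0 := by
  have : IsProbabilityMeasure (Pr.map Z) := Measure.isProbabilityMeasure_map hZ.aemeasurable
  have : IsProbabilityMeasure (Pr.map W) := Measure.isProbabilityMeasure_map hW.aemeasurable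
  rw [← integral_map (hW.prodMk hZ).aemeasurable hφ.aestronglyMeasurable,
    (indepFun_iff_map_prod_eq_prod_map_map hW.aemeasurable hZ.aemeasurable).1 hWZ]
  by_cases hint : Integrable φ ((Pr.map W).prod (Pr.map Z))
  · simp only [integral_prod _ hint, h0, integral_zero]
  · exact integral_undef hint

lemma indepFun_prodMk_left {𝒜 : Type*} [MeasurableSpace 𝒜] {A : Ω → 𝒜} (hA : Measurable A)
    (hW : Measurable W) (hZ : Measurable Z) (hAWZ : IndepFun A (fun ω => (W ω, Z ω)) Pr)
    (hWZ : IndepFun W Z Pr) : IndepFun (fun ω => (A ω, W ω)) Z Pr := by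
  have : IsProbabilityMeasure (Pr.map Z) := Measure.isProbabilityMeasure_map hZ.aemeasurable
  have : IsProbabilityMeasure (Pr.map W) := Measure.isProbabilityMeasure_map hW.aemeasurable
  have : IsProbabilityMeasure (Pr.map A) := Measure.isProbabilityMeasure_map hA.aemeasurable
  have hAW : IndepFun A W Pr := hAWZ.comp measurable_id measurable_fst
  have hlaw := (indepFun_iff_map_prod_eq_prod_map_map hA.aemeasurable
    (hW.prodMk hZ).aemeasurable).1 hAWZ
  rw [(indepFun_iff_map_prod_eq_prod_map_map hW.aemeasurable hZ.aemeasurable).1 hWZ] at hlaw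
  rw [indepFun_iff_map_prod_eq_prod_map_map (hA.prodMk hW).aemeasurable hZ.aemeasurable,
    (indepFun_iff_map_prod_eq_prod_map_map hA.aemeasurable hW.aemeasurable).1 hAW,
    ← (measurePreserving_prodAssoc (Pr.map A) (Pr.map W) (Pr.map Z)).symm.map_eq, ← hlaw,
    Measure.map_map (MeasurableEquiv.measurable _) (hA.prodMk (hW.prodMk hZ))]
  rfl

end Independence

section Orthogonal

variable {Ω ι : Type*} [MeasurableSpace Ω] {Pr : Measure Ω} {s : Finset ι} {H : ι → Ω → ℝ}

lemma lintegral_enorm_sq_eq_ofReal_integral {X : Ω → ℝ} (hX : MemLp X 2 Pr) :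
    ∫⁻ ω, ‖X ω‖ₑ ^ 2 ∂Pr = ENNReal.ofReal (∫ ω, X ω ^ 2 ∂Pr) := by
  rw [ofReal_integral_eq_lintegral_ofReal hX.integrable_sq (ae_of_all _ fun _ => sq_nonneg _)]
  simp only [← Real.enorm_eq_ofReal (sq_nonneg _), enorm_pow]

lemma memLp_two_of_lintegral_enorm_sq_ne_top {X : Ω → ℝ} (hX : AEStronglyMeasurable X Pr)
    (h : ∫⁻ ω, ‖X ω‖ₑ ^ 2 ∂Pr ≠ ⊤) : MemLp X 2 Pr := by
  refine ⟨hX, ?_⟩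
  rw [eLpNorm_lt_top_iff_lintegral_rpow_enorm_lt_top (by norm_num) (by norm_num)]
  simpa using h.lt_top

lemma lintegral_enorm_div_natCast_le {X : Ω → ℝ} {n : ℕ} {c : ENNReal}
    (h : ∫⁻ ω, ‖X ω‖ₑ ∂Pr ≤ n * c) : ∫⁻ ω, ‖X ω / n‖ₑ ∂Pr ≤ c := by
  rcases n.eq_zero_or_pos with rfl | hn
  · simp
  have hn' : (n : ℝ) ≠ 0 := by positivity
  simp only [div_eq_mul_inv, enorm_mul, enorm_inv hn', Real.enorm_natCast]
  rw [lintegral_mul_const' _ _ (by simp [hn.ne']), ← div_eq_mul_inv]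
  exact ENNReal.div_le_of_le_mul' h

lemma integral_sum_sq_of_orthogonal (hH : ∀ i ∈ s, MemLp (H i) 2 Pr)
    (ho : ∀ i ∈ s, ∀ i' ∈ s, i ≠ i' → ∫ ω, H i ω * H i' ω ∂Pr = 0) :
    ∫ ω, (∑ i ∈ s, H i ω) ^ 2 ∂Pr = ∑ i ∈ s, ∫ ω, H i ω ^ 2 ∂Pr := by
  have hint : ∀ i ∈ s, ∀ i' ∈ s, Integrable (fun ω => H i ω * H i' ω) Pr :=
    fun i hi i' hi' => (hH i hi).integrable_mul (hH i' hi')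
  simp_rw [sq, Finset.sum_mul_sum]
  rw [integral_finsetSum _ fun i hi => integrable_finsetSum _ (hint i hi)]
  refine Finset.sum_congr rfl fun i hi => ?_
  rw [integral_finsetSum _ (hint i hi)]
  exact Finset.sum_eq_single i (fun i' hi' hne => ho i hi i' hi' hne.symm) (absurd hi)

lemma lintegral_enorm_sum_sq_le_of_orthogonal {c : ENNReal} (hc : c ≠ ⊤)
    (hH : ∀ i ∈ s, AEStronglyMeasurable (H i) Pr) (hHc : ∀ i ∈ s, ∫⁻ ω, ‖H i ω‖ₑ ^ 2 ∂Pr ≤ c)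
    (ho : ∀ i ∈ s, ∀ i' ∈ s, i ≠ i' → ∫ ω, H i ω * H i' ω ∂Pr = 0) :
    ∫⁻ ω, ‖∑ i ∈ s, H i ω‖ₑ ^ 2 ∂Pr ≤ s.card * c := by
  have hL2 : ∀ i ∈ s, MemLp (H i) 2 Pr := fun i hi =>
    memLp_two_of_lintegral_enorm_sq_ne_top (hH i hi) (ne_top_of_le_ne_top hc (hHc i hi))
  rw [lintegral_enorm_sq_eq_ofReal_integral (memLp_finsetSum _ hL2),
    integral_sum_sq_of_orthogonal hL2 ho,
    ENNReal.ofReal_sum_of_nonneg fun i _ => integral_nonneg fun _ => sq_nonneg _, ← nsmul_eq_mul]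
  refine Finset.sum_le_card_nsmul _ _ _ fun i hi => ?_
  rw [← lintegral_enorm_sq_eq_ofReal_integral (hL2 i hi)]
  exact hHc i hi

lemma lintegral_enorm_sub_integral_sq_le [IsProbabilityMeasure Pr] {X : Ω → ℝ}
    (hX : AEStronglyMeasurable X Pr) :
    ∫⁻ ω, ‖X ω - ∫ ω', X ω' ∂Pr‖ₑ ^ 2 ∂Pr ≤ ∫⁻ ω, ‖X ω‖ₑ ^ 2 ∂Pr := by
  by_cases htop : ∫⁻ ω, ‖X ω‖ₑ ^ 2 ∂Pr = ⊤
  · exact htop ▸ le_top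
  have hL2 := memLp_two_of_lintegral_enorm_sq_ne_top hX htop
  rw [lintegral_enorm_sq_eq_ofReal_integral hL2]
  change evariance X Pr ≤ _
  rw [← ofReal_variance hL2]
  exact ENNReal.ofReal_le_ofReal (variance_le_expectation_sq hX)

end Orthogonal

/-! ### Cross-fitting -/

section HeldOut

variable {Ω ι 𝒰 𝒵 : Type*} [MeasurableSpace 𝒵] {Q : Measure 𝒵} {f : 𝒰 → (ι → 𝒵) → 𝒵 → ℝ}
  {u : 𝒰} {d : ι → 𝒵} {c : ENNReal}

/-- The fitting procedure `f` with the result replaced by `0` if its second moment under `Q`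
exceeds `c`. -/
noncomputable def truncateFit (Q : Measure 𝒵) (c : ENNReal) (f : 𝒰 → (ι → 𝒵) → 𝒵 → ℝ)
    (u : 𝒰) (d : ι → 𝒵) (z : 𝒵) : ℝ :=
  {d | ∫⁻ z, ‖f u d z‖ₑ ^ 2 ∂Q ≤ c}.indicator (fun d => f u d z) d

/-- The fitting procedure `f` with the result centered under `Q`. -/
noncomputable def centerFit (Q : Measure 𝒵) (f : 𝒰 → (ι → 𝒵) → 𝒵 → ℝ)
    (u : 𝒰) (d : ι → 𝒵) (z : 𝒵) : ℝ :=
  f u d z - ∫ z', f u d z' ∂Q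

lemma truncateFit_of_le (h : ∫⁻ z, ‖f u d z‖ₑ ^ 2 ∂Q ≤ c) :
    truncateFit Q c f u d = f u d := by
  funext z
  simp [truncateFit, h]

lemma lintegral_truncateFit_le : ∫⁻ z, ‖truncateFit Q c f u d z‖ₑ ^ 2 ∂Q ≤ c := by
  by_cases h : ∫⁻ z, ‖f u d z‖ₑ ^ 2 ∂Q ≤ c <;> simp [truncateFit, h]

lemma integral_centerFit [IsProbabilityMeasure Q] (hf : AEStronglyMeasurable (f u d) Q)
    (h : ∫⁻ z, ‖f u d z‖ₑ ^ 2 ∂Q ≠ ⊤) : ∫ z, centerFit Q f u d z ∂Q = 0 := by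
  have hint := (memLp_two_of_lintegral_enorm_sq_ne_top hf h).integrable one_le_two
  simp [centerFit, integral_sub hint (integrable_const _)]

variable [MeasurableSpace 𝒰]

/-- A randomized fitting procedure `f` that holds out part of the data: from randomness `u` and
data `d` it produces a function `f u d` of an observation, without looking at the observations in
the set `A u` of indices. -/
structure IsHeldOutFit (A : 𝒰 → Set ι) (f : 𝒰 → (ι → 𝒵) → 𝒵 → ℝ) : Prop where
  measurableSet_heldOut : ∀ i, MeasurableSet {u | i ∈ A u}
  measurable_fit : Measurable fun q : 𝒰 × (ι → 𝒵) × 𝒵 => f q.1 q.2.1 q.2.2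
  fit_congr : ∀ u d d', (∀ i ∉ A u, d i = d' i) → f u d = f u d'

variable {A : 𝒰 → Set ι}

namespace IsHeldOutFit

lemma measurable_apply (hf : IsHeldOutFit A f) (u : 𝒰) (d : ι → 𝒵) : Measurable (f u d) :=
  hf.measurable_fit.comp (measurable_const.prodMk (measurable_const.prodMk measurable_id))

protected lemma truncateFit [SFinite Q] (hf : IsHeldOutFit A f) :
    IsHeldOutFit A (truncateFit Q c f) where
  measurableSet_heldOut := hf.measurableSet_heldOut
  measurable_fit := by
    have hfit : Measurable fun q : (𝒰 × (ι → 𝒵) × 𝒵) × 𝒵 => ‖f q.1.1 q.1.2.1 q.2‖ₑ ^ 2 :=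
      (hf.measurable_fit.comp (measurable_fst.fst.prodMk
        (measurable_fst.snd.fst.prodMk measurable_snd))).enorm.pow_const 2
    exact hf.measurable_fit.indicator (measurableSet_le hfit.lintegral_prod_right' measurable_const)
  fit_congr u d d' h := by
    funext z
    simp only [truncateFit, Set.indicator, Set.mem_ofPred_eq, hf.fit_congr u d d' h]

protected lemma centerFit [SFinite Q] (hf : IsHeldOutFit A f) :
    IsHeldOutFit A (centerFit Q f) where
  measurableSet_heldOut := hf.measurableSet_heldOut
  measurable_fit := by
    have hfit : Measurable fun q : (𝒰 × (ι → 𝒵) × 𝒵) × 𝒵 => f q.1.1 q.1.2.1 q.2 :=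
      hf.measurable_fit.comp (measurable_fst.fst.prodMk
        (measurable_fst.snd.fst.prodMk measurable_snd))
    exact hf.measurable_fit.sub hfit.stronglyMeasurable.integral_prod_right'.measurable
  fit_congr u d d' h := by
    funext z
    simp only [centerFit, hf.fit_congr u d d' h]

end IsHeldOutFit

variable [MeasurableSpace Ω] {Pr : Measure Ω} {U : Ω → 𝒰} {Z : ι → Ω → 𝒵}

/-- Independent observations `Z` together with randomness `U` that is independent of them: the
input of a fitting procedure as in `IsHeldOutFit`. -/
structure IsIndepSample (Pr : Measure Ω) (U : Ω → 𝒰) (Z : ι → Ω → 𝒵) : Prop where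
  measurable_aux : Measurable U
  measurable_obs : ∀ i, Measurable (Z i)
  indep_obs : iIndepFun Z Pr
  indep_aux : IndepFun U (fun ω i => Z i ω) Pr

/-- The fitted function evaluated at observation `i`, or `0` if `i` is not held out. -/
noncomputable def heldOutScore (A : 𝒰 → Set ι) (f : 𝒰 → (ι → 𝒵) → 𝒵 → ℝ) (U : Ω → 𝒰)
    (Z : ι → Ω → 𝒵) (i : ι) (ω : Ω) : ℝ :=
  {u | i ∈ A u}.indicator (fun u => f u (fun i' => Z i' ω) (Z i ω)) (U ω)

lemma IsHeldOutFit.measurable_heldOutScore (hf : IsHeldOutFit A f) (hs : IsIndepSample Pr U Z)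
    (i : ι) : Measurable (heldOutScore A f U Z i) :=
  (hf.measurable_fit.comp (hs.measurable_aux.prodMk
    ((measurable_pi_lambda _ hs.measurable_obs).prodMk (hs.measurable_obs i)))).indicator
      (hs.measurable_aux (hf.measurableSet_heldOut i))

lemma IsHeldOutFit.fit_update [DecidableEq ι] (hf : IsHeldOutFit A f) {i : ι} (hi : i ∈ A u)
    (z : 𝒵) :
    f u (Function.update d i z) = f u d :=
  hf.fit_congr u _ _ fun _ hi' => Function.update_of_ne (fun h => hi' (by rwa [h])) _ _

variable [Finite ι] [IsProbabilityMeasure Pr]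

lemma IsIndepSample.indepFun_update [DecidableEq ι] (hs : IsIndepSample Pr U Z) (i : ι) (z : 𝒵) :
    IndepFun (fun ω => (U ω, Function.update (fun i' => Z i' ω) i z)) (Z i) Pr := by
  have := Fintype.ofFinite ι
  have hZ : Measurable fun ω i' => Z i' ω := measurable_pi_lambda _ hs.measurable_obs
  have hupd : Measurable fun d : ι → 𝒵 => Function.update d i z := measurable_update_left
  refine indepFun_prodMk_left hs.measurable_aux (hupd.comp hZ) (hs.measurable_obs i)
    (hs.indep_aux.comp measurable_id (hupd.prodMk (measurable_pi_apply i))) ?_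
  have hsplit := hs.indep_obs.indepFun_finset {i}ᶜ {i} disjoint_compl_left hs.measurable_obs
  have hfill : Measurable fun (d : ({i}ᶜ : Finset ι) → 𝒵) (i' : ι) =>
      if h : i' ∈ ({i}ᶜ : Finset ι) then d ⟨i', h⟩ else z :=
    measurable_pi_lambda _ fun i' => by split_ifs <;> fun_prop
  convert hsplit.comp hfill (measurable_pi_apply ⟨i, Finset.mem_singleton_self i⟩) using 1
  · funext ω i'
    by_cases h : i' = i <;> simp [h, Function.update]
  · rfl

namespace IsHeldOutFit

lemma lintegral_heldOutScore_sq_le (hf : IsHeldOutFit A f) (hs : IsIndepSample Pr U Z)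
    (hc : ∀ u d, ∫⁻ z, ‖f u d z‖ₑ ^ 2 ∂Q ≤ c) {i : ι} (hi : Pr.map (Z i) = Q) :
    ∫⁻ ω, ‖heldOutScore A f U Z i ω‖ₑ ^ 2 ∂Pr ≤ c := by
  classical
  subst hi
  obtain ⟨ω₀⟩ := nonempty_of_isProbabilityMeasure Pr
  set z₀ := Z i ω₀
  have hW : Measurable fun ω => (U ω, Function.update (fun i' => Z i' ω) i z₀) :=
    hs.measurable_aux.prodMk (measurable_update_left.comp
      (measurable_pi_lambda _ hs.measurable_obs))
  calc ∫⁻ ω, ‖heldOutScore A f U Z i ω‖ₑ ^ 2 ∂Pr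
      ≤ ∫⁻ ω, ‖f (U ω) (Function.update (fun i' => Z i' ω) i z₀) (Z i ω)‖ₑ ^ 2 ∂Pr := by
        refine lintegral_mono fun ω => ?_
        by_cases hi : i ∈ A (U ω)
        · simp [heldOutScore, hi, hf.fit_update hi]
        · simp [heldOutScore, hi]
    _ ≤ c := lintegral_comp_le_of_indepFun hW (hs.measurable_obs i) (hs.indepFun_update i z₀)
        (φ := fun q => ‖f q.1.1 q.1.2 q.2‖ₑ ^ 2)
        ((hf.measurable_fit.comp (measurable_fst.fst.prodMk
          (measurable_fst.snd.prodMk measurable_snd))).enorm.pow_const 2) fun w => hc w.1 w.2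

lemma integral_heldOutScore_mul_heldOutScore (hf : IsHeldOutFit A f) (hs : IsIndepSample Pr U Z)
    (h0 : ∀ u d, ∫ z, f u d z ∂Q = 0) {i i' : ι} (hi : Pr.map (Z i) = Q) (hne : i' ≠ i) :
    ∫ ω, heldOutScore A f U Z i ω * heldOutScore A f U Z i' ω ∂Pr = 0 := by
  classical
  subst hi
  obtain ⟨ω₀⟩ := nonempty_of_isProbabilityMeasure Pr
  set z₀ := Z i ω₀
  have hW : Measurable fun ω => (U ω, Function.update (fun i' => Z i' ω) i z₀) :=
    hs.measurable_aux.prodMk (measurable_update_left.comp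
      (measurable_pi_lambda _ hs.measurable_obs))
  let φ : (𝒰 × (ι → 𝒵)) × 𝒵 → ℝ := fun q =>
    {u | i ∈ A u ∧ i' ∈ A u}.indicator (fun u => f u q.1.2 q.2 * f u q.1.2 (q.1.2 i')) q.1.1
  have hφ : Measurable φ := by
    refine Measurable.indicator (.mul ?_ ?_) (measurable_fst.fst
      ((hf.measurableSet_heldOut i).inter (hf.measurableSet_heldOut i')))
    · exact hf.measurable_fit.comp (measurable_fst.fst.prodMk
        (measurable_fst.snd.prodMk measurable_snd))
    · exact hf.measurable_fit.comp (measurable_fst.fst.prodMk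
        (measurable_fst.snd.prodMk ((measurable_pi_apply i').comp measurable_fst.snd)))
  have hscore : ∀ ω, heldOutScore A f U Z i ω * heldOutScore A f U Z i' ω =
      φ ((U ω, Function.update (fun i' => Z i' ω) i z₀), Z i ω) := by
    intro ω
    by_cases hi : i ∈ A (U ω)
    · by_cases hi' : i' ∈ A (U ω) <;>
        simp [heldOutScore, φ, hi, hi', hf.fit_update hi, Function.update_of_ne hne]
    · simp [heldOutScore, φ, hi]
  simp_rw [hscore]
  refine integral_comp_eq_zero_of_indepFun hW (hs.measurable_obs i) (hs.indepFun_update i z₀) hφ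
    fun w => ?_
  by_cases hw : i ∈ A w.1 ∧ i' ∈ A w.1
  · simp [φ, hw, integral_mul_const, h0]
  · simp [φ, hw]

variable {s : Finset ι} [IsProbabilityMeasure Q]

lemma controlledBy_mean_sq (hf : IsHeldOutFit A f) (hs : IsIndepSample Pr U Z)
    (hsQ : ∀ i ∈ s, Pr.map (Z i) = Q) :
    ControlledBy Pr (fun ω => (∑ i ∈ s, heldOutScore A f U Z i ω ^ 2) / s.card)
      fun ω => ∫⁻ z, ‖f (U ω) (fun i => Z i ω) z‖ₑ ^ 2 ∂Q := by
  intro c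
  have hfc := hf.truncateFit (Q := Q) (c := c)
  have hmeas := hfc.measurable_heldOutScore hs
  refine ⟨fun ω => (∑ i ∈ s, heldOutScore A (truncateFit Q c f) U Z i ω ^ 2) / s.card,
    by fun_prop, lintegral_enorm_div_natCast_le ?_, fun ω hω => ?_⟩
  · calc ∫⁻ ω, ‖∑ i ∈ s, heldOutScore A (truncateFit Q c f) U Z i ω ^ 2‖ₑ ∂Pr
        ≤ ∫⁻ ω, ∑ i ∈ s, ‖heldOutScore A (truncateFit Q c f) U Z i ω‖ₑ ^ 2 ∂Pr :=
          lintegral_mono fun ω => (enorm_sum_le _ _).trans_eq (by simp only [enorm_pow])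
      _ = ∑ i ∈ s, ∫⁻ ω, ‖heldOutScore A (truncateFit Q c f) U Z i ω‖ₑ ^ 2 ∂Pr :=
          lintegral_finsetSum _ fun i _ => (hmeas i).enorm.pow_const 2
      _ ≤ s.card * c := by
          rw [← nsmul_eq_mul]
          exact Finset.sum_le_card_nsmul _ _ _ fun i hi =>
            hfc.lintegral_heldOutScore_sq_le hs (fun _ _ => lintegral_truncateFit_le) (hsQ i hi)
  · simp only [heldOutScore, truncateFit_of_le hω, Set.indicator]

lemma controlledBy_sq_sum_centerFit (hf : IsHeldOutFit A f) (hs : IsIndepSample Pr U Z)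
    (hsQ : ∀ i ∈ s, Pr.map (Z i) = Q) :
    ControlledBy Pr (fun ω => (∑ i ∈ s, heldOutScore A (centerFit Q f) U Z i ω) ^ 2 / s.card)
      fun ω => ∫⁻ z, ‖f (U ω) (fun i => Z i ω) z‖ₑ ^ 2 ∂Q := by
  intro c
  have hfc := hf.truncateFit (Q := Q) (c := c)
  have hmeas := hfc.centerFit (Q := Q).measurable_heldOutScore hs
  have hsq : ∀ u d, ∫⁻ z, ‖centerFit Q (truncateFit Q c f) u d z‖ₑ ^ 2 ∂Q ≤ c := fun u d =>
    (lintegral_enorm_sub_integral_sq_le (hfc.measurable_apply u d).aestronglyMeasurable).trans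
      lintegral_truncateFit_le
  have hmean : ∀ u d, ∫ z, centerFit Q (truncateFit Q c f) u d z ∂Q = 0 := fun u d =>
    integral_centerFit (hfc.measurable_apply u d).aestronglyMeasurable
      (ne_top_of_le_ne_top ENNReal.coe_ne_top lintegral_truncateFit_le)
  refine ⟨fun ω =>
      (∑ i ∈ s, heldOutScore A (centerFit Q (truncateFit Q c f)) U Z i ω) ^ 2 / s.card,
    by fun_prop, lintegral_enorm_div_natCast_le ?_, fun ω hω => ?_⟩
  · simp only [enorm_pow]
    exact lintegral_enorm_sum_sq_le_of_orthogonal ENNReal.coe_ne_top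
      (fun i _ => (hmeas i).aestronglyMeasurable)
      (fun i hi => hfc.centerFit.lintegral_heldOutScore_sq_le hs hsq (hsQ i hi))
      (fun i hi i' _ hne =>
        hfc.centerFit.integral_heldOutScore_mul_heldOutScore hs hmean (hsQ i hi) hne.symm)
  · simp only [heldOutScore, centerFit, truncateFit_of_le hω, Set.indicator]

end IsHeldOutFit

end HeldOut

/-! ### Sample means -/

section SampleMean

variable {n : ℕ} {ι : Type*} {a b : Fin n → ℝ}

lemma sampleMean_add (a b : Fin n → ℝ) :
    sampleMean (fun i => a i + b i) = sampleMean a + sampleMean b := by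
  simp [sampleMean, Finset.sum_add_distrib, add_div]

lemma sampleMean_sub (a b : Fin n → ℝ) :
    sampleMean (fun i => a i - b i) = sampleMean a - sampleMean b := by
  simp [sampleMean, Finset.sum_sub_distrib, sub_div]

lemma sampleMean_const_mul (c : ℝ) (a : Fin n → ℝ) :
    sampleMean (fun i => c * a i) = c * sampleMean a := by
  simp [sampleMean, ← Finset.mul_sum, mul_div_assoc]

lemma sampleMean_sum (s : Finset ι) (a : ι → Fin n → ℝ) :
    sampleMean (fun i => ∑ c ∈ s, a c i) = ∑ c ∈ s, sampleMean (a c) := by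
  simp only [sampleMean, Finset.sum_comm (t := s), Finset.sum_div]

lemma sampleMean_comm {m : ℕ} (a : Fin n → Fin m → ℝ) :
    sampleMean (fun i => sampleMean (a i)) = sampleMean fun k => sampleMean fun i => a i k := by
  simp only [sampleMean, ← Finset.sum_div, Finset.sum_comm (s := Finset.univ (α := Fin n)),
    div_right_comm]

lemma tendsto_sampleMean_zero {F : Filter ι} {a : Fin n → ι → ℝ}
    (h : ∀ i, Tendsto (a i) F (𝓝 0)) : Tendsto (fun q => sampleMean fun i => a i q) F (𝓝 0) := by
  simpa [sampleMean] using (tendsto_finsetSum Finset.univ fun i _ => h i).div_const (n : ℝ)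

lemma sampleMean_nonneg (h : ∀ i, 0 ≤ a i) : 0 ≤ sampleMean a :=
  div_nonneg (Finset.sum_nonneg fun i _ => h i) (Nat.cast_nonneg n)

lemma sampleMean_mono (h : ∀ i, a i ≤ b i) : sampleMean a ≤ sampleMean b :=
  div_le_div_of_nonneg_right (Finset.sum_le_sum fun i _ => h i) (Nat.cast_nonneg n)

lemma natCast_mul_sampleMean (a : Fin n → ℝ) : (n : ℝ) * sampleMean a = ∑ i, a i := by
  rcases eq_or_ne n 0 with rfl | hn
  · simp
  · exact mul_div_cancel₀ _ (Nat.cast_ne_zero.2 hn)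

lemma sampleMean_mul_sq_le (a b : Fin n → ℝ) :
    sampleMean (fun i => a i * b i) ^ 2 ≤
      sampleMean (fun i => a i ^ 2) * sampleMean (fun i => b i ^ 2) := by
  simp only [sampleMean]
  rw [div_pow, div_mul_div_comm, ← sq]
  exact div_le_div_of_nonneg_right (Finset.sum_mul_sq_le_sq_mul_sq _ _ _) (by positivity)

lemma sampleMean_sq_le (a : Fin n → ℝ) : sampleMean a ^ 2 ≤ sampleMean fun i => a i ^ 2 := by
  have h := sampleMean_mul_sq_le a fun _ => 1
  have hone : sampleMean (fun _ : Fin n => (1 : ℝ) ^ 2) ≤ 1 := by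
    simpa [sampleMean] using div_self_le_one (n : ℝ)
  simp only [mul_one] at h
  exact h.trans (mul_le_of_le_one_right (sampleMean_nonneg fun i => sq_nonneg _) hone)

lemma sqrt_mul_div_sub (n : ℕ) (s c : ℝ) : √n * (s / n - c) = (√n)⁻¹ * (s - n * c) := by
  rcases eq_or_ne n 0 with rfl | hn
  · simp
  · have hn' : (n : ℝ) ≠ 0 := Nat.cast_ne_zero.2 hn
    have hsqrt : √(n : ℝ) ≠ 0 := (Real.sqrt_pos.2 (by positivity)).ne'
    rw [eq_inv_mul_iff_mul_eq₀ hsqrt, ← mul_assoc, Real.mul_self_sqrt n.cast_nonneg, mul_sub,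
      mul_div_cancel₀ _ hn']

end SampleMean

/-! ### Limit theorems for rows of independent, identically distributed observations -/

section Rows

variable {Ω Ω' 𝒵 ι : Type*} [MeasurableSpace Ω] [MeasurableSpace Ω'] [MeasurableSpace 𝒵]
  {Pr : Measure Ω} {Q : Measure 𝒵} {Z : ι → Ω → 𝒵} {h : 𝒵 → ℝ}

lemma measurable_sampleMean_comp {n : ℕ} (hh : Measurable h) :
    Measurable fun z : Fin n → 𝒵 => sampleMean fun i => h (z i) := by
  unfold sampleMean
  fun_prop

/-- The family `Z` is an i.i.d. sample from the law `Q`. -/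
structure IsIID (Pr : Measure Ω) (Q : Measure 𝒵) (Z : ι → Ω → 𝒵) : Prop where
  measurable : ∀ i, Measurable (Z i)
  map_eq : ∀ i, Pr.map (Z i) = Q
  indep : iIndepFun Z Pr

lemma IsIID.precomp {ι' : Type*} (hZ : IsIID Pr Q Z) {e : ι' → ι} (he : e.Injective) :
    IsIID Pr Q fun i => Z (e i) where
  measurable i := hZ.measurable (e i)
  map_eq i := hZ.map_eq (e i)
  indep := hZ.indep.precomp he

lemma IsIID.memLp_comp (hZ : IsIID Pr Q Z) (hL2 : MemLp h 2 Q) (i : ι) :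
    MemLp (fun ω => h (Z i ω)) 2 Pr :=
  (hZ.map_eq i ▸ hL2 : MemLp h 2 (Pr.map (Z i))).comp_of_map (hZ.measurable i).aemeasurable

lemma IsIID.variance_comp (hZ : IsIID Pr Q Z) (hh : Measurable h) (i : ι) :
    variance (fun ω => h (Z i ω)) Pr = variance h Q := by
  rw [← hZ.map_eq i, variance_map hh.aemeasurable (hZ.measurable i).aemeasurable]
  rfl

lemma IsIID.integral_comp (hZ : IsIID Pr Q Z) (hh : Measurable h) (i : ι) :
    ∫ ω, h (Z i ω) ∂Pr = ∫ z, h z ∂Q := by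
  rw [← hZ.map_eq i, integral_map (hZ.measurable i).aemeasurable hh.aestronglyMeasurable]

variable [IsProbabilityMeasure Pr]

lemma IsIID.identDistrib [Finite ι] {Pr' : Measure Ω'} [IsProbabilityMeasure Pr']
    {Z' : ι → Ω' → 𝒵} (hZ : IsIID Pr Q Z) (hZ' : IsIID Pr' Q Z') :
    IdentDistrib (fun ω i => Z i ω) (fun ω i => Z' i ω) Pr Pr' where
  aemeasurable_fst := (measurable_pi_lambda _ hZ.measurable).aemeasurable
  aemeasurable_snd := (measurable_pi_lambda _ hZ'.measurable).aemeasurable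
  map_eq := by
    have := Fintype.ofFinite ι
    rw [(iIndepFun_iff_map_fun_eq_pi_map fun i => (hZ.measurable i).aemeasurable).1 hZ.indep,
      (iIndepFun_iff_map_fun_eq_pi_map fun i => (hZ'.measurable i).aemeasurable).1 hZ'.indep]
    simp only [hZ.map_eq, hZ'.map_eq]

lemma bddAlong_sampleMean_of_isIID {n : ℕ → ℕ} {Z : ∀ m, Fin (n m) → Ω → 𝒵}
    (hZ : ∀ m, IsIID Pr Q (Z m)) (hh : Measurable h) (hL2 : MemLp h 2 Q) :
    BddAlong (inProb Pr) fun q : ℕ × Ω =>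
      √(n q.1 : ℝ) * ((sampleMean fun i => h (Z q.1 i q.2)) - ∫ z, h z ∂Q) := by
  have hsum : ∀ m, variance (fun ω => ∑ i, h (Z m i ω)) Pr = n m * variance h Q := fun m => by
    have h1 := IndepFun.variance_sum (s := Finset.univ) (X := fun i ω => h (Z m i ω)) (μ := Pr)
      (fun i _ => (hZ m).memLp_comp hL2 i)
      (fun i _ i' _ hne => ((hZ m).indep.indepFun hne).comp hh hh)
    simpa [(hZ m).variance_comp hh, Finset.sum_fn] using h1
  have hmem : ∀ m, MemLp (fun ω => ∑ i, h (Z m i ω)) 2 Pr := fun m =>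
    memLp_finsetSum _ fun i _ => (hZ m).memLp_comp hL2 i
  have hmean : ∀ m, ∫ ω, ∑ i, h (Z m i ω) ∂Pr = n m * ∫ z, h z ∂Q := fun m => by
    rw [integral_finsetSum _ fun i _ => ((hZ m).memLp_comp hL2 i).integrable (by norm_num)]
    simp [(hZ m).integral_comp hh]
  have hbdd := bddAlong_sub_integral_of_variance_le (Pr := Pr) (C := variance h Q)
    (X := fun m ω => (√(n m : ℝ))⁻¹ * ∑ i, h (Z m i ω)) (fun m => (hmem m).const_mul _) fun m => by
      rw [variance_const_mul, hsum, inv_pow, Real.sq_sqrt (Nat.cast_nonneg _), ← mul_assoc]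
      exact mul_le_of_le_one_left (variance_nonneg h Q) inv_mul_le_one
  simpa only [integral_const_mul, hmean, ← mul_sub, ← sqrt_mul_div_sub, sampleMean] using hbdd

variable [IsProbabilityMeasure Q]

lemma isIID_infinitePi (Q : Measure 𝒵) [IsProbabilityMeasure Q] :
    IsIID (Measure.infinitePi fun _ : ι => Q) Q fun i x => x i where
  measurable := measurable_pi_apply
  map_eq := Measure.infinitePi_map_eval fun _ : ι => Q
  indep := iIndepFun_infinitePi (P := fun _ : ι => Q) (X := fun _ z => z) fun _ => measurable_id

lemma IsIID.identDistrib_sampleMean {n : ℕ} {Z : Fin n → Ω → 𝒵} (hZ : IsIID Pr Q Z)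
    (hh : Measurable h) :
    IdentDistrib (fun ω => sampleMean fun i => h (Z i ω))
      (fun x => (∑ i ∈ Finset.range n, h (x i)) / n) Pr (Measure.infinitePi fun _ : ℕ => Q) := by
  simpa [Function.comp_def, sampleMean, Finset.sum_range] using
    (hZ.identDistrib ((isIID_infinitePi Q).precomp Fin.val_injective)).comp
      (measurable_sampleMean_comp hh)

lemma identDistrib_infinitePi_eval (hh : Measurable h) (i : ι) :
    IdentDistrib (fun x : ι → 𝒵 => h (x i)) h (Measure.infinitePi fun _ : ι => Q) Q where
  aemeasurable_fst := (hh.comp (measurable_pi_apply i)).aemeasurable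
  aemeasurable_snd := hh.aemeasurable
  map_eq := by
    conv_rhs => rw [← (isIID_infinitePi Q).map_eq i, Measure.map_map hh (measurable_pi_apply i)]
    rfl

lemma iIndepFun_infinitePi_eval (hh : Measurable h) :
    iIndepFun (fun i (x : ι → 𝒵) => h (x i)) (Measure.infinitePi fun _ : ι => Q) :=
  iIndepFun_infinitePi (P := fun _ : ι => Q) (X := fun _ z => h z) fun _ => hh

variable {n : ℕ → ℕ} {Z : ∀ m, Fin (n m) → Ω → 𝒵}

theorem tendsto_sampleMean_of_isIID (hn : Tendsto n atTop atTop) (hZ : ∀ m, IsIID Pr Q (Z m))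
    (hh : Measurable h) (hint : Integrable h Q) :
    Tendsto (fun q : ℕ × Ω => sampleMean fun i => h (Z q.1 i q.2)) (inProb Pr)
      (𝓝 (∫ z, h z ∂Q)) := by
  have hid := fun i : ℕ => identDistrib_infinitePi_eval (Q := Q) hh i
  have hstrong := strong_law_ae_real (fun i (x : ℕ → 𝒵) => h (x i))
    ((hid 0).integrable_iff.2 hint)
    (fun i k hik => (iIndepFun_infinitePi_eval hh).indepFun hik)
    (fun i => (hid i).trans (hid 0).symm)
  rw [(hid 0).integral_eq] at hstrong
  have hweak := tendstoInMeasure_of_tendsto_ae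
    (fun n => Measurable.aestronglyMeasurable (by fun_prop)) hstrong
  rw [← tendstoInMeasure_const_iff (X := fun m ω => sampleMean fun i => h (Z m i ω))]
  intro ε hε
  refine ((hweak ε hε).comp hn).congr fun m => ?_
  exact (((hZ m).identDistrib_sampleMean hh).measure_mem_eq
    (s := {s | ε ≤ edist s (∫ z, h z ∂Q)}) (measurableSet_le (by fun_prop) (by fun_prop))).symm

theorem tendstoInDistribution_sampleMean_of_isIID (hn : Tendsto n atTop atTop)
    (hZ : ∀ m, IsIID Pr Q (Z m)) (hh : Measurable h) (hL2 : MemLp h 2 Q) :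
    TendstoInDistribution
      (fun m ω => √(n m : ℝ) * ((sampleMean fun i => h (Z m i ω)) - ∫ z, h z ∂Q)) atTop
      (id : ℝ → ℝ) (fun _ => Pr) (gaussianReal 0 (variance h Q).toNNReal) := by
  have hid := fun i : ℕ => identDistrib_infinitePi_eval (Q := Q) hh i
  have hclt := tendstoInDistribution_inv_sqrt_mul_sum_sub
    (P := Measure.infinitePi fun _ : ℕ => Q) (X := fun i x => h (x i))
    (Y := id) (P' := gaussianReal 0 (variance h Q).toNNReal)
    (by rw [(hid 0).variance_eq]; exact HasLaw.id) ((hid 0).memLp_iff.2 hL2)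
    (iIndepFun_infinitePi_eval hh) (fun i => (hid i).trans (hid 0).symm)
  simp only [← sqrt_mul_div_sub, (hid 0).integral_eq] at hclt
  have hident := fun m => ((hZ m).identDistrib_sampleMean hh).comp
    (u := fun s => √(n m : ℝ) * (s - ∫ z, h z ∂Q)) (by fun_prop)
  exact ⟨fun m => (hident m).aemeasurable_fst, aemeasurable_id,
    (hclt.tendsto.comp hn).congr fun m => Subtype.ext (hident m).map_eq.symm⟩

end Rows

section Gaussian

variable {Ω : Type*} [MeasurableSpace Ω] {Pr : Measure Ω} [IsProbabilityMeasure Pr]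
  {X Y : ℕ → Ω → ℝ} {v w : NNReal}

lemma tendstoInDistribution_gaussian_add (hXY : ∀ m, IndepFun (X m) (Y m) Pr)
    (hX : TendstoInDistribution X atTop (id : ℝ → ℝ) (fun _ => Pr) (gaussianReal 0 v))
    (hY : TendstoInDistribution Y atTop (id : ℝ → ℝ) (fun _ => Pr) (gaussianReal 0 w)) :
    TendstoInDistribution (fun m ω => X m ω + Y m ω) atTop (id : ℝ → ℝ) (fun _ => Pr)
      (gaussianReal 0 (v + w)) := by
  refine ⟨fun m => (hX.forall_aemeasurable m).add (hY.forall_aemeasurable m), aemeasurable_id,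
    ProbabilityMeasure.tendsto_iff_tendsto_charFun.2 fun t => ?_⟩
  have hlim := (ProbabilityMeasure.tendsto_iff_tendsto_charFun.1 hX.tendsto t).mul
    (ProbabilityMeasure.tendsto_iff_tendsto_charFun.1 hY.tendsto t)
  simp only [ProbabilityMeasure.coe_mk, Measure.map_id, ← charFun_conv,
    gaussianReal_conv_gaussianReal, add_zero] at hlim ⊢
  refine hlim.congr fun m => ?_
  rw [charFun_conv, (hXY m).charFun_map_fun_add_eq_mul (hX.forall_aemeasurable m)
    (hY.forall_aemeasurable m), Pi.mul_apply]

lemma tendstoInDistribution_gaussian_mul {c : ℕ → ℝ} {d : ℝ} (hc : Tendsto c atTop (𝓝 d))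
    (hX : TendstoInDistribution X atTop (id : ℝ → ℝ) (fun _ => Pr) (gaussianReal 0 v)) :
    TendstoInDistribution (fun m ω => c m * X m ω) atTop (id : ℝ → ℝ) (fun _ => Pr)
      (gaussianReal 0 ((d ^ 2).toNNReal * v)) := by
  have hlim := hX.continuous_comp_prodMk_of_tendstoInMeasure_const (Y := fun m _ => c m) (c := d)
    (g := fun q : ℝ × ℝ => q.2 * q.1) (by fun_prop)
    (tendstoInMeasure_const_iff.2 (hc.comp tendsto_fst_inProb)) (fun _ => aemeasurable_const)
  refine ⟨hlim.forall_aemeasurable, aemeasurable_id, ?_⟩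
  convert! hlim.tendsto using 2
  refine congrArg 𝓝 (Subtype.ext ?_)
  have hscale := gaussianReal_map_const_mul (μ := 0) (v := v) d
  rw [mul_zero, ← Real.toNNReal_of_nonneg (sq_nonneg d)] at hscale
  exact Measure.map_id.trans hscale.symm

end Gaussian

/-! ### Stability of sample moments and of the PPI++ estimator -/

section PooledMoments

variable {n N : ℕ} (y fL : Fin n → ℝ) (fU : Fin N → ℝ)

lemma sampleCov_eq : sampleCov y fL = (n : ℝ) / (n - 1) *
    (sampleMean (fun i => y i * fL i) - sampleMean y * sampleMean fL) := by
  have hexpand : ∑ i, (y i - sampleMean y) * (fL i - sampleMean fL) =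
      n * (sampleMean (fun i => y i * fL i) - sampleMean y * sampleMean fL) := by
    simp only [sub_mul, mul_sub, Finset.sum_sub_distrib, ← Finset.sum_mul, ← Finset.mul_sum,
      ← natCast_mul_sampleMean, Finset.sum_const, Finset.card_univ, Fintype.card_fin, nsmul_eq_mul]
    ring
  rw [sampleCov, hexpand, mul_div_right_comm]

lemma natCast_add_mul_pooledMean :
    ((n : ℝ) + N) * pooledMean fL fU = ∑ i, fL i + ∑ i, fU i := by
  rcases Nat.eq_zero_or_pos (n + N) with h | h
  · obtain ⟨rfl, rfl⟩ := Nat.add_eq_zero_iff.1 h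
    simp
  · exact mul_div_cancel₀ _ (by exact_mod_cast h.ne')

lemma pooledVar_eq : pooledVar fL fU = ((n : ℝ) + N) / (n + N - 1) *
    (pooledMean (fun i => fL i ^ 2) (fun i => fU i ^ 2) - pooledMean fL fU ^ 2) := by
  have hexpand : ∑ i, (fL i - pooledMean fL fU) ^ 2 + ∑ i, (fU i - pooledMean fL fU) ^ 2 =
      (n + N) * (pooledMean (fun i => fL i ^ 2) (fun i => fU i ^ 2) - pooledMean fL fU ^ 2) := by
    rw [mul_sub, natCast_add_mul_pooledMean]
    simp only [sub_sq, Finset.sum_add_distrib, Finset.sum_sub_distrib, ← Finset.sum_mul,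
      ← Finset.mul_sum, Finset.sum_const, Finset.card_univ, Fintype.card_fin, nsmul_eq_mul]
    linear_combination (2 * pooledMean fL fU) * natCast_add_mul_pooledMean fL fU
  rw [pooledVar, hexpand, mul_div_right_comm]

variable {fL fU} in
lemma abs_pooledMean_sub_le (h : 0 < n + N) (e : ℝ) :
    |pooledMean fL fU - e| ≤ |sampleMean fL - e| + |sampleMean fU - e| := by
  have hpos : (0 : ℝ) < n + N := by exact_mod_cast h
  have hsplit : ((n : ℝ) + N) * (pooledMean fL fU - e) =
      n * (sampleMean fL - e) + N * (sampleMean fU - e) := by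
    rw [mul_sub, natCast_add_mul_pooledMean, ← natCast_mul_sampleMean, ← natCast_mul_sampleMean]
    ring
  refine le_of_mul_le_mul_left ?_ hpos
  calc ((n : ℝ) + N) * |pooledMean fL fU - e|
      = |n * (sampleMean fL - e) + N * (sampleMean fU - e)| := by
        rw [← hsplit, abs_mul, abs_of_pos hpos]
    _ ≤ n * |sampleMean fL - e| + N * |sampleMean fU - e| := by
        simpa [abs_mul] using abs_add_le ((n : ℝ) * (sampleMean fL - e)) (N * (sampleMean fU - e))
    _ ≤ (n + N) * (|sampleMean fL - e| + |sampleMean fU - e|) := by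
        nlinarith [mul_nonneg n.cast_nonneg (abs_nonneg (sampleMean fU - e)),
          mul_nonneg N.cast_nonneg (abs_nonneg (sampleMean fL - e))]

end PooledMoments

section Along

variable {α : Type*} {F : Filter α} {n N : α → ℕ} {y a f f' : ∀ q, Fin (n q) → ℝ}
  {u u' : ∀ q, Fin (N q) → ℝ} {c e ey ef : ℝ}

/-- The rows `f q` and `f' q` merge in empirical mean square along the filter `F`. -/
def MeanSqClose (F : Filter α) (f f' : ∀ q, Fin (n q) → ℝ) : Prop :=
  Tendsto (fun q => sampleMean fun i => (f q i - f' q i) ^ 2) F (𝓝 0)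

lemma MeanSqClose.tendsto_sampleMean_mul (hff' : MeanSqClose F f f')
    (ha : Tendsto (fun q => sampleMean fun i => a q i ^ 2) F (𝓝 c))
    (haf' : Tendsto (fun q => sampleMean fun i => a q i * f' q i) F (𝓝 e)) :
    Tendsto (fun q => sampleMean fun i => a q i * f q i) F (𝓝 e) := by
  have hsq : Tendsto (fun q => (sampleMean fun i => a q i * (f q i - f' q i)) ^ 2) F (𝓝 0) :=
    squeeze_zero (fun _ => sq_nonneg _) (fun _ => sampleMean_mul_sq_le _ _)
      (by simpa using ha.mul hff')
  have hzero := tendsto_zero_of_sq hsq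
  simpa [← sampleMean_add, mul_sub] using haf'.add hzero

lemma MeanSqClose.tendsto_sampleMean (hff' : MeanSqClose F f f')
    (hf' : Tendsto (fun q => sampleMean (f' q)) F (𝓝 e)) :
    Tendsto (fun q => sampleMean (f q)) F (𝓝 e) := by
  have hsq : Tendsto (fun q => (sampleMean fun i => f q i - f' q i) ^ 2) F (𝓝 0) :=
    squeeze_zero (fun _ => sq_nonneg _) (fun _ => sampleMean_sq_le _) hff'
  simpa [← sampleMean_add] using hf'.add (tendsto_zero_of_sq hsq)

lemma MeanSqClose.tendsto_sampleMean_sq (hff' : MeanSqClose F f f')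
    (hf' : Tendsto (fun q => sampleMean fun i => f' q i ^ 2) F (𝓝 e)) :
    Tendsto (fun q => sampleMean fun i => f q i ^ 2) F (𝓝 e) := by
  have hmul := hff'.tendsto_sampleMean_mul hf' (e := e) (by simpa only [← sq] using hf')
  have h := ((hmul.const_mul 2).sub hf').add hff'
  rw [two_mul, add_sub_cancel_right, add_zero] at h
  refine h.congr fun q => ?_
  rw [← sampleMean_const_mul, ← sampleMean_sub, ← sampleMean_add]
  exact congrArg sampleMean (funext fun i => by ring)

lemma tendsto_div_sub_one {x : α → ℝ} (hx : Tendsto x F atTop) :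
    Tendsto (fun q => x q / (x q - 1)) F (𝓝 1) := by
  have h : Tendsto (fun q => (1 - (x q)⁻¹)⁻¹) F (𝓝 1) := by
    simpa using (hx.inv_tendsto_atTop.const_sub 1).inv₀ (by norm_num)
  refine h.congr' ?_
  filter_upwards [hx.eventually_ne_atTop 0] with q hq
  rw [← inv_div, sub_div, div_self hq, one_div]

lemma tendsto_sampleCov (hn : Tendsto n F atTop)
    (hy : Tendsto (fun q => sampleMean (y q)) F (𝓝 ey))
    (hf : Tendsto (fun q => sampleMean (f q)) F (𝓝 ef))
    (hyf : Tendsto (fun q => sampleMean fun i => y q i * f q i) F (𝓝 e)) :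
    Tendsto (fun q => sampleCov (y q) (f q)) F (𝓝 (e - ey * ef)) := by
  simpa [sampleCov_eq] using
    (tendsto_div_sub_one (tendsto_natCast_atTop_atTop.comp hn)).mul (hyf.sub (hy.mul hf))

lemma tendsto_pooledMean (hn : Tendsto n F atTop)
    (hf : Tendsto (fun q => sampleMean (f q)) F (𝓝 e))
    (hu : Tendsto (fun q => sampleMean (u q)) F (𝓝 e)) :
    Tendsto (fun q => pooledMean (f q) (u q)) F (𝓝 e) := by
  rw [tendsto_iff_norm_sub_tendsto_zero] at hf hu ⊢
  refine squeeze_zero' (.of_forall fun _ => norm_nonneg _) ?_ (by simpa using hf.add hu)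
  filter_upwards [hn.eventually_gt_atTop 0] with q hq
  exact abs_pooledMean_sub_le (Nat.add_pos_left hq _) e

lemma tendsto_pooledVar (hn : Tendsto n F atTop)
    (hf : Tendsto (fun q => sampleMean (f q)) F (𝓝 ef))
    (hf2 : Tendsto (fun q => sampleMean fun i => f q i ^ 2) F (𝓝 e))
    (hu : Tendsto (fun q => sampleMean (u q)) F (𝓝 ef))
    (hu2 : Tendsto (fun q => sampleMean fun i => u q i ^ 2) F (𝓝 e)) :
    Tendsto (fun q => pooledVar (f q) (u q)) F (𝓝 (e - ef ^ 2)) := by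
  have hsize : Tendsto (fun q => (n q : ℝ) + N q) F atTop :=
    tendsto_atTop_mono (fun q => le_add_of_nonneg_right (Nat.cast_nonneg _))
      (tendsto_natCast_atTop_atTop.comp hn)
  simpa [pooledVar_eq] using (tendsto_div_sub_one hsize).mul
    ((tendsto_pooledMean hn hf2 hu2).sub ((tendsto_pooledMean hn hf hu).pow 2))

lemma tendsto_lambdaHat {ρ v : ℝ} (hρ : 0 ≤ ρ) (hN : Tendsto N F atTop)
    (hnN : Tendsto (fun q => (n q : ℝ) / (N q : ℝ)) F (𝓝 ρ))
    (hcov : Tendsto (fun q => sampleCov (y q) (f q)) F (𝓝 c))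
    (hvar : Tendsto (fun q => pooledVar (f q) (u q)) F (𝓝 v)) (hv : v ≠ 0) :
    Tendsto (fun q => lambdaHat (y q) (f q) (u q)) F (𝓝 (c / ((1 + ρ) * v))) := by
  have hweight : Tendsto (fun q => (N q : ℝ) / (n q + N q)) F (𝓝 (1 + ρ)⁻¹) := by
    refine ((hnN.const_add 1).inv₀ (by positivity)).congr' ?_
    filter_upwards [hN.eventually_ne_atTop 0] with q hq
    rw [← inv_div _ (N q : ℝ), add_div, div_self (Nat.cast_ne_zero.2 hq), add_comm]
  rw [← div_div, div_eq_inv_mul c, mul_div_assoc]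
  exact hweight.mul (hcov.div hvar hv)

lemma tendsto_mul_ppiPlusPlus_sub {s : α → ℝ} {l : ℝ}
    (hl : Tendsto (fun q => lambdaHat (y q) (f q) (u q)) F (𝓝 l))
    (hb : BddAlong F fun q => s q * (sampleMean (f' q) - sampleMean (u' q)))
    (hd : Tendsto (fun q => s q * ((sampleMean (f q) - sampleMean (f' q)) -
      (sampleMean (u q) - sampleMean (u' q)))) F (𝓝 0)) :
    Tendsto (fun q => s q * (ppiPlusPlus (y q) (f q) (u q) - ppiWith l (y q) (f' q) (u' q))) F
      (𝓝 0) := by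
  have hcoef := hb (fun q => l - lambdaHat (y q) (f q) (u q)) (by simpa using hl.const_sub l)
  have h := hcoef.sub (hl.mul hd)
  rw [mul_zero, sub_zero] at h
  refine h.congr fun q => ?_
  simp only [ppiPlusPlus, ppiWith]
  ring

end Along

/-! ### Linear control functions with perturbed coefficients and predictions -/

section Linear

variable {p : ℕ}

lemma feature_zero (g : ℝ) (x : EuclideanSpace ℝ (Fin p)) : feature g x 0 = 1 := rfl

lemma feature_one (g : ℝ) (x : EuclideanSpace ℝ (Fin p)) : feature g x 1 = g := rfl

lemma feature_succ_succ (g : ℝ) (x : EuclideanSpace ℝ (Fin p)) (c : Fin p) :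
    feature g x c.succ.succ = x c := rfl

lemma linPred_sub_linPred (b β : Coef p) (yh g : ℝ) (x : EuclideanSpace ℝ (Fin p)) :
    linPred b (feature yh x) - linPred β (feature g x) =
      (∑ c, (b c - β c) * feature g x c) + b 1 * (yh - g) := by
  simp only [linPred, Fin.sum_univ_succ, feature_zero, Fin.succ_zero_eq_one, feature_one,
    feature_succ_succ, sub_mul, Finset.sum_sub_distrib]
  ring

lemma linPred_sub_sq_le (b β : Coef p) (yh g : ℝ) (x : EuclideanSpace ℝ (Fin p)) :
    (linPred b (feature yh x) - linPred β (feature g x)) ^ 2 ≤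
      2 * (∑ c, (b c - β c) ^ 2) * (∑ c, feature g x c ^ 2) + 2 * b 1 ^ 2 * (yh - g) ^ 2 := by
  have hcs := Finset.sum_mul_sq_le_sq_mul_sq Finset.univ (fun c => b c - β c) (feature g x)
  calc (linPred b (feature yh x) - linPred β (feature g x)) ^ 2
      ≤ 2 * ((∑ c, (b c - β c) * feature g x c) ^ 2 + (b 1 * (yh - g)) ^ 2) := by
        rw [linPred_sub_linPred]
        exact add_sq_le
    _ ≤ _ := by linarith [mul_pow (b 1) (yh - g) 2]

variable {α : Type*} {F : Filter α} {n N : α → ℕ} {b : α → Coef p} {β : Coef p}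
  {yh g : ∀ q, Fin (n q) → ℝ} {x : ∀ q, Fin (n q) → EuclideanSpace ℝ (Fin p)}
  {yh' g' : ∀ q, Fin (N q) → ℝ} {x' : ∀ q, Fin (N q) → EuclideanSpace ℝ (Fin p)}

lemma tendsto_coord (hb : Tendsto b F (𝓝 β)) (c : Fin (p + 2)) :
    Tendsto (fun q => b q c) F (𝓝 (β c)) :=
  ((by fun_prop : Continuous fun z : Coef p => z c).tendsto β).comp hb

lemma meanSqClose_linPred (hb : Tendsto b F (𝓝 β)) {v : Fin (p + 2) → ℝ}
    (hz : ∀ c, Tendsto (fun q => sampleMean fun i => feature (g q i) (x q i) c ^ 2) F (𝓝 (v c)))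
    (hyg : MeanSqClose F yh g) :
    MeanSqClose F (fun q i => linPred (b q) (feature (yh q i) (x q i)))
      (fun q i => linPred β (feature (g q i) (x q i))) := by
  have hcoef : Tendsto (fun q => ∑ c, (b q c - β c) ^ 2) F (𝓝 0) := by
    simpa using tendsto_finsetSum Finset.univ fun c _ =>
      ((tendsto_coord hb c).sub_const (β c)).pow 2
  have hbound := ((hcoef.const_mul 2).mul (tendsto_finsetSum Finset.univ fun c _ => hz c)).add
    ((((tendsto_coord hb 1).pow 2).const_mul 2).mul hyg)
  rw [mul_zero, mul_zero, zero_mul, add_zero] at hbound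
  refine squeeze_zero (fun q => sampleMean_nonneg fun i => sq_nonneg _) (fun q => ?_) hbound
  simp only [← sampleMean_sum, ← sampleMean_const_mul, ← sampleMean_add]
  exact sampleMean_mono fun i => linPred_sub_sq_le _ _ _ _ _

lemma sampleMean_linPred_sub {n : ℕ} (b β : Coef p) (yh g : Fin n → ℝ)
    (x : Fin n → EuclideanSpace ℝ (Fin p)) :
    sampleMean (fun i => linPred b (feature (yh i) (x i))) -
        sampleMean (fun i => linPred β (feature (g i) (x i))) =
      (∑ c, (b c - β c) * sampleMean fun i => feature (g i) (x i) c) +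
        b 1 * sampleMean fun i => yh i - g i := by
  simp only [← sampleMean_sub, linPred_sub_linPred, sampleMean_add, sampleMean_sum,
    sampleMean_const_mul]

lemma tendsto_mul_sampleMean_linPred_sub {s : α → ℝ} (hb : Tendsto b F (𝓝 β))
    (hz : ∀ c, BddAlong F fun q => s q * (sampleMean (fun i => feature (g q i) (x q i) c) -
      sampleMean (fun i => feature (g' q i) (x' q i) c)))
    (hyg : Tendsto (fun q => s q * (sampleMean (fun i => yh q i - g q i) -
      sampleMean (fun i => yh' q i - g' q i))) F (𝓝 0)) :
    Tendsto (fun q => s q *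
      ((sampleMean (fun i => linPred (b q) (feature (yh q i) (x q i))) -
          sampleMean (fun i => linPred β (feature (g q i) (x q i)))) -
        (sampleMean (fun i => linPred (b q) (feature (yh' q i) (x' q i))) -
          sampleMean (fun i => linPred β (feature (g' q i) (x' q i)))))) F (𝓝 0) := by
  have hcoef := tendsto_finsetSum Finset.univ fun c _ =>
    hz c (fun q => b q c - β c) (by simpa using (tendsto_coord hb c).sub_const (β c))
  have h := hcoef.add ((tendsto_coord hb 1).mul hyg)
  simp only [Finset.sum_const_zero, mul_zero, add_zero] at h
  refine h.congr fun q => ?_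
  simp only [sampleMean_linPred_sub, mul_sub, mul_add, Finset.mul_sum, Finset.sum_sub_distrib,
    mul_left_comm (s q)]
  ring

end Linear

/-! ### Errors of the cross-fitted predictions -/

lemma inv_sqrt_natCast_le_one (n : ℕ) : (√(n : ℝ))⁻¹ ≤ 1 := by
  rcases n.eq_zero_or_pos with rfl | hn
  · simp
  · exact inv_le_one_of_one_le₀ (Real.one_le_sqrt.2 (by exact_mod_cast hn))

lemma inv_sqrt_natCast_mul_sq (n : ℕ) (a : ℝ) : ((√(n : ℝ))⁻¹ * a) ^ 2 = a ^ 2 / n := by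
  rw [inv_mul_eq_div, div_pow, Real.sq_sqrt n.cast_nonneg]

lemma abs_card_fiber_sub_div_le {n K : ℕ} {φ : Fin n → Fin K}
    (h : ∀ k k', (Finset.univ.filter fun i => φ i = k).card ≤
      (Finset.univ.filter fun i => φ i = k').card + 1) (k : Fin K) :
    |((Finset.univ.filter fun i => φ i = k).card : ℝ) - n / K| ≤ 1 := by
  set a : Fin K → ℝ := fun k => ((Finset.univ.filter fun i => φ i = k).card : ℝ)
  have hK : (0 : ℝ) < K := by exact_mod_cast k.pos
  have hsum : ∑ k', a k' = n := by
    have := Finset.card_eq_sum_card_fiberwise (f := φ) (s := Finset.univ) (t := Finset.univ)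
      (fun _ _ => by simp)
    rw [Finset.card_univ, Fintype.card_fin] at this
    simp only [a]
    exact_mod_cast this.symm
  have hle : ∀ k k', a k ≤ a k' + 1 := fun k k' => by
    simp only [a]
    exact_mod_cast h k k'
  have hdiff : ∀ k', |a k - a k'| ≤ 1 := fun k' =>
    abs_sub_le_iff.2 ⟨sub_le_iff_le_add'.2 (hle k k'), sub_le_iff_le_add'.2 (hle k' k)⟩
  calc |a k - n / K| = |∑ k', (a k - a k')| / K := by
        rw [← abs_of_pos hK, ← abs_div, abs_of_pos hK, Finset.sum_sub_distrib, hsum]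
        simp [sub_div, hK.ne']
    _ ≤ (∑ _k' : Fin K, 1) / K := by
        gcongr
        exact (Finset.abs_sum_le_sum_abs _ _).trans (Finset.sum_le_sum fun k' _ => hdiff k')
    _ = 1 := by simp [hK.ne']

namespace Run

section Decomposition

variable {J R K p : ℕ} {𝒱 𝒰 Ω : Type*} (S : Run J R K p 𝒱 𝒰 Ω)

lemma yhatLab_sub_eq_sum (g : 𝒱 → ℝ) (j : Fin J) (ω : Ω) (i : Fin (S.n j)) :
    S.yhatLab j ω i - g (S.lab j i ω).2.1 = ∑ k, if S.fold (S.aux ω) j i = k then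
      S.ghat k ω (S.lab j i ω).2.1 - g (S.lab j i ω).2.1 else 0 := by
  simp [yhatLab]

lemma yhatLab_sub_sq_eq_sum (g : 𝒱 → ℝ) (j : Fin J) (ω : Ω) (i : Fin (S.n j)) :
    (S.yhatLab j ω i - g (S.lab j i ω).2.1) ^ 2 = ∑ k, if S.fold (S.aux ω) j i = k then
      (S.ghat k ω (S.lab j i ω).2.1 - g (S.lab j i ω).2.1) ^ 2 else 0 := by
  simp [yhatLab]

lemma yhatUnl_sub_eq_sampleMean (hK : 0 < K) (g : 𝒱 → ℝ) (j : Fin J) (ω : Ω) (i : Fin (S.N j)) :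
    S.yhatUnl j ω i - g (S.unl j i ω).1 =
      sampleMean fun k => S.ghat k ω (S.unl j i ω).1 - g (S.unl j i ω).1 := by
  have : (K : ℝ) ≠ 0 := by positivity
  simp [yhatUnl, sampleMean, Finset.sum_sub_distrib, sub_div, this]

lemma sqrt_mul_sampleMean_yhatLab_sub (g : 𝒱 → ℝ) (j : Fin J) (ω : Ω) (b : Fin K → ℝ) :
    √(S.n j) * (sampleMean (fun i => S.yhatLab j ω i - g (S.lab j i ω).2.1) - sampleMean b) =
      ∑ k, ((√(S.n j))⁻¹ * (∑ i, if S.fold (S.aux ω) j i = k then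
          S.ghat k ω (S.lab j i ω).2.1 - g (S.lab j i ω).2.1 - b k else 0) +
        (√(S.n j))⁻¹ * ((Finset.univ.filter fun i => S.fold (S.aux ω) j i = k).card - S.n j / K) *
          b k) := by
  have hfold : ∀ k, (∑ i, if S.fold (S.aux ω) j i = k then
      S.ghat k ω (S.lab j i ω).2.1 - g (S.lab j i ω).2.1 - b k else 0) =
      (∑ i, if S.fold (S.aux ω) j i = k then
        S.ghat k ω (S.lab j i ω).2.1 - g (S.lab j i ω).2.1 else 0) -
      (Finset.univ.filter fun i => S.fold (S.aux ω) j i = k).card * b k := fun k => by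
    rw [← Finset.sum_filter, ← Finset.sum_filter, Finset.sum_sub_distrib, Finset.sum_const,
      nsmul_eq_mul]
  rw [sampleMean, sqrt_mul_div_sub]
  simp only [yhatLab_sub_eq_sum, hfold]
  rw [Finset.sum_comm, sampleMean, Finset.sum_div, Finset.mul_sum, ← Finset.sum_sub_distrib,
    Finset.mul_sum]
  exact Finset.sum_congr rfl fun k _ => by ring

lemma sqrt_mul_sampleMean_yhatUnl_sub (hK : 0 < K) (g : 𝒱 → ℝ) (j : Fin J) (ω : Ω)
    (b : Fin K → ℝ) :
    √(S.N j) * (sampleMean (fun i => S.yhatUnl j ω i - g (S.unl j i ω).1) - sampleMean b) =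
      sampleMean fun k => (√(S.N j))⁻¹ * ∑ i,
        (S.ghat k ω (S.unl j i ω).1 - g (S.unl j i ω).1 - b k) := by
  simp only [yhatUnl_sub_eq_sampleMean S hK]
  rw [sampleMean, sqrt_mul_div_sub, ← sampleMean_sum, ← sampleMean_const_mul, ← sampleMean_sub,
    ← sampleMean_const_mul]
  simp [Finset.sum_sub_distrib]

/-- The error of the photo model of fold `k` as a fitting procedure that holds out fold `k`; the
labeled fields of all zones form one family. -/
def labErrorFit (g : 𝒱 → ℝ) (k : Fin K) (u : 𝒰)
    (d : (Σ j, Fin (S.n j)) → Labeled 𝒱 p) (z : Labeled 𝒱 p) : ℝ :=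
  S.train k u (Sigma.curry d) z.2.1 - g z.2.1

/-- The error of the photo model of fold `k` as a fitting procedure that holds out all unlabeled
fields of zone `j`; the labeled data are part of its randomness. -/
def unlErrorFit (g : 𝒱 → ℝ) (k : Fin K) (j : Fin J)
    (u : 𝒰 × ((j : Fin J) → Fin (S.n j) → Labeled 𝒱 p)) (_ : Fin (S.N j) → Unlabeled 𝒱 p)
    (w : Unlabeled 𝒱 p) : ℝ :=
  S.train k u.1 u.2 w.1 - g w.1

variable {S}

lemma heldOutScore_labErrorFit {g : 𝒱 → ℝ} {k : Fin K} {ω : Ω} {j : Fin J}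
    (i : Fin (S.n j)) :
    heldOutScore (fun u => {a | S.fold u a.1 a.2 = k}) (S.labErrorFit g k) S.aux
      (fun a => S.lab a.1 a.2) ⟨j, i⟩ ω = if S.fold (S.aux ω) j i = k then
        S.ghat k ω (S.lab j i ω).2.1 - g (S.lab j i ω).2.1 else 0 := by
  rw [heldOutScore, Set.indicator_apply]
  rfl

lemma heldOutScore_unlErrorFit {g : 𝒱 → ℝ} {k : Fin K} {ω : Ω} {j : Fin J}
    (i : Fin (S.N j)) :
    heldOutScore (fun _ => Set.univ) (S.unlErrorFit g k j) (fun ω => (S.aux ω, S.labData ω))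
      (S.unl j) i ω = S.ghat k ω (S.unl j i ω).1 - g (S.unl j i ω).1 := by
  simp [heldOutScore, unlErrorFit, ghat]

end Decomposition

section Errors

variable {J R K p : ℕ} {𝒱 𝒰 Ω : Type*} [MeasurableSpace 𝒱]

/-- The `L²` distance between the photo model of fold `k` and `g` under the law `Q` of a labeled
field. -/
noncomputable def ghatDist (S : Run J R K p 𝒱 𝒰 Ω) (Q : Measure (Labeled 𝒱 p)) (g : 𝒱 → ℝ)
    (k : Fin K) (ω : Ω) : ENNReal :=
  eLpNorm (fun z => S.ghat k ω z.2.1 - g z.2.1) 2 Q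

/-- The mean error of the photo model of fold `k` under the law `Q` of a labeled field. -/
noncomputable def ghatBias (S : Run J R K p 𝒱 𝒰 Ω) (Q : Measure (Labeled 𝒱 p)) (g : 𝒱 → ℝ)
    (k : Fin K) (ω : Ω) : ℝ :=
  ∫ z, (S.ghat k ω z.2.1 - g z.2.1) ∂Q

variable {S : Run J R K p 𝒱 𝒰 Ω} {Q : Measure (Labeled 𝒱 p)} {g : 𝒱 → ℝ} {k : Fin K} {ω : Ω}

lemma lintegral_labErrorFit_sq :
    ∫⁻ z, ‖S.labErrorFit g k (S.aux ω) (fun a => S.lab a.1 a.2 ω) z‖ₑ ^ 2 ∂Q =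
      S.ghatDist Q g k ω ^ 2 := by
  have h := eLpNorm_nnreal_pow_eq_lintegral (f := fun z => S.ghat k ω z.2.1 - g z.2.1) (μ := Q)
    (p := 2) two_ne_zero
  simp only [NNReal.coe_ofNat, ENNReal.coe_ofNat, ENNReal.rpow_ofNat] at h
  exact h.symm

lemma heldOutScore_centerFit_labErrorFit {j : Fin J} (i : Fin (S.n j)) :
    heldOutScore (fun u => {a | S.fold u a.1 a.2 = k}) (centerFit Q (S.labErrorFit g k)) S.aux
      (fun a => S.lab a.1 a.2) ⟨j, i⟩ ω = if S.fold (S.aux ω) j i = k then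
        S.ghat k ω (S.lab j i ω).2.1 - g (S.lab j i ω).2.1 - S.ghatBias Q g k ω else 0 := by
  rw [heldOutScore, Set.indicator_apply]
  rfl

variable [MeasurableSpace 𝒰]

/-- The rules of `IsValid` that concern the folds and the photo models, but not the
coefficients. -/
structure IsCrossFitted (S : Run J R K p 𝒱 𝒰 Ω) : Prop where
  measurable_fold : ∀ j i, Measurable fun u => S.fold u j i
  fold_even : ∀ u j k k', (Finset.univ.filter fun i => S.fold u j i = k).card ≤
    (Finset.univ.filter fun i => S.fold u j i = k').card + 1
  measurable_train : ∀ k, Measurable fun q : 𝒰 × ((j : Fin J) → Fin (S.n j) → Labeled 𝒱 p) × 𝒱 =>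
    S.train k q.1 q.2.1 q.2.2
  train_outside_fold : ∀ k u d d', (∀ j i, S.fold u j i ≠ k → d j i = d' j i) →
    S.train k u d = S.train k u d'

lemma IsValid.isCrossFitted [MeasurableSpace Ω] (hS : S.IsValid) : S.IsCrossFitted :=
  ⟨hS.measurable_fold, hS.fold_even, hS.measurable_train, hS.train_outside_fold⟩

namespace IsCrossFitted

lemma measurable_ghat_apply (hS : S.IsCrossFitted) (k : Fin K) (ω : Ω) :
    Measurable (S.ghat k ω) :=
  (hS.measurable_train k).comp
    (measurable_const.prodMk (measurable_const.prodMk measurable_id))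

lemma measurable_unlError (hS : S.IsCrossFitted) (hg : Measurable g) (k : Fin K) (ω : Ω) :
    Measurable fun w : Unlabeled 𝒱 p => S.ghat k ω w.1 - g w.1 :=
  ((hS.measurable_ghat_apply k ω).comp measurable_fst).sub (hg.comp measurable_fst)

lemma enorm_ghatBias_le [IsProbabilityMeasure Q] (hS : S.IsCrossFitted) (hg : Measurable g) :
    ‖S.ghatBias Q g k ω‖ₑ ≤ S.ghatDist Q g k ω := by
  refine (enorm_integral_le_lintegral_enorm _).trans ?_
  rw [← eLpNorm_one_eq_lintegral_enorm]
  exact eLpNorm_le_eLpNorm_of_exponent_le one_le_two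
    ((hS.measurable_unlError hg k ω).comp measurable_snd).aestronglyMeasurable

lemma lintegral_unlErrorFit_sq (hS : S.IsCrossFitted) (hg : Measurable g) {j : Fin J}
    (d : Fin (S.N j) → Unlabeled 𝒱 p) :
    ∫⁻ w, ‖S.unlErrorFit g k j (S.aux ω, S.labData ω) d w‖ₑ ^ 2 ∂(Q.map Prod.snd) =
      S.ghatDist Q g k ω ^ 2 := by
  rw [← lintegral_labErrorFit_sq]
  exact lintegral_map ((hS.measurable_unlError hg k ω).enorm.pow_const 2) measurable_snd

lemma heldOutScore_centerFit_unlErrorFit (hS : S.IsCrossFitted) (hg : Measurable g) {j : Fin J}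
    (i : Fin (S.N j)) :
    heldOutScore (fun _ => Set.univ) (centerFit (Q.map Prod.snd) (S.unlErrorFit g k j))
      (fun ω => (S.aux ω, S.labData ω)) (S.unl j) i ω =
        S.ghat k ω (S.unl j i ω).1 - g (S.unl j i ω).1 - S.ghatBias Q g k ω := by
  have hbias : ∫ w, (S.ghat k ω w.1 - g w.1) ∂(Q.map Prod.snd) = S.ghatBias Q g k ω :=
    integral_map measurable_snd.aemeasurable (hS.measurable_unlError hg k ω).aestronglyMeasurable
  simp [← hbias, heldOutScore, centerFit, unlErrorFit, ghat]

lemma isHeldOutFit_labErrorFit (hS : S.IsCrossFitted) (hg : Measurable g) (k : Fin K) :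
    IsHeldOutFit (fun u => {a | S.fold u a.1 a.2 = k}) (S.labErrorFit g k) where
  measurableSet_heldOut a := hS.measurable_fold a.1 a.2 (measurableSet_singleton k)
  measurable_fit := by
    have hcurry : Measurable fun (d : (Σ j, Fin (S.n j)) → Labeled 𝒱 p) j i => d ⟨j, i⟩ :=
      measurable_pi_lambda _ fun j => measurable_pi_lambda _ fun i => measurable_pi_apply _
    exact ((hS.measurable_train k).comp (measurable_fst.prodMk
      ((hcurry.comp measurable_snd.fst).prodMk measurable_snd.snd.snd.fst))).sub
        (hg.comp measurable_snd.snd.snd.fst)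
  fit_congr u d d' h := by
    funext z
    rw [labErrorFit, labErrorFit,
      hS.train_outside_fold k u (Sigma.curry d) (Sigma.curry d') fun j i hi => h ⟨j, i⟩ hi]

lemma isHeldOutFit_unlErrorFit (hS : S.IsCrossFitted) (hg : Measurable g) (k : Fin K)
    (j : Fin J) : IsHeldOutFit (fun _ => Set.univ) (S.unlErrorFit g k j) where
  measurableSet_heldOut _ := by simp
  measurable_fit := ((hS.measurable_train k).comp (measurable_fst.fst.prodMk
    (measurable_fst.snd.prodMk measurable_snd.snd.fst))).sub (hg.comp measurable_snd.snd.fst)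
  fit_congr _ _ _ _ := rfl

end IsCrossFitted

variable [MeasurableSpace Ω] {Pr : Measure Ω} {P : Fin J → Measure (Labeled 𝒱 p)}

namespace IsSample

lemma measurable_labData (hsample : S.IsSample P Pr) : Measurable S.labData :=
  measurable_pi_lambda _ fun j => measurable_pi_lambda _ fun i => hsample.measurable_lab j i

lemma measurable_unlData (hsample : S.IsSample P Pr) : Measurable S.unlData :=
  measurable_pi_lambda _ fun j => measurable_pi_lambda _ fun i => hsample.measurable_unl j i

lemma isIndepSample_lab (hsample : S.IsSample P Pr) :
    IsIndepSample Pr S.aux fun a : Σ j, Fin (S.n j) => S.lab a.1 a.2 where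
  measurable_aux := hsample.measurable_aux
  measurable_obs a := hsample.measurable_lab a.1 a.2
  indep_obs := hsample.indep_lab
  indep_aux := by
    have hflat : Measurable fun (d : ((j : Fin J) → Fin (S.n j) → Labeled 𝒱 p) ×
        ((j : Fin J) → Fin (S.N j) → Unlabeled 𝒱 p)) (a : Σ j, Fin (S.n j)) => d.1 a.1 a.2 :=
      measurable_pi_lambda _ fun a => by fun_prop
    exact hsample.indep_aux.comp measurable_id hflat

lemma isIndepSample_unl [IsProbabilityMeasure Pr] (hsample : S.IsSample P Pr) (j : Fin J) :
    IsIndepSample Pr (fun ω => (S.aux ω, S.labData ω)) (S.unl j) where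
  measurable_aux := hsample.measurable_aux.prodMk hsample.measurable_labData
  measurable_obs := hsample.measurable_unl j
  indep_obs := hsample.indep_unl j
  indep_aux := (indepFun_prodMk_left hsample.measurable_aux hsample.measurable_labData
    hsample.measurable_unlData hsample.indep_aux hsample.indep_lab_unl).comp measurable_id
      (measurable_pi_apply j)

end IsSample

variable [IsProbabilityMeasure Pr] {j : Fin J} [IsProbabilityMeasure (P j)]

namespace IsCrossFitted

lemma controlledBy_lab_sq (hS : S.IsCrossFitted) (hsample : S.IsSample P Pr) (hg : Measurable g)
    (k : Fin K) :
    ControlledBy Pr (fun ω => sampleMean fun i => if S.fold (S.aux ω) j i = k then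
        (S.ghat k ω (S.lab j i ω).2.1 - g (S.lab j i ω).2.1) ^ 2 else 0)
      (fun ω => S.ghatDist (P j) g k ω ^ 2) := by
  have h := (hS.isHeldOutFit_labErrorFit hg k).controlledBy_mean_sq hsample.isIndepSample_lab
    (s := Finset.univ.map (.sigmaMk j)) (Q := P j) (by simpa using hsample.law_lab j)
  simpa only [sampleMean, Finset.sum_map, Finset.card_map, Finset.card_univ, Fintype.card_fin,
    Function.Embedding.sigmaMk_apply, heldOutScore_labErrorFit, ite_pow, zero_pow two_ne_zero,
    lintegral_labErrorFit_sq] using h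

lemma controlledBy_sq_lab_centered (hS : S.IsCrossFitted) (hsample : S.IsSample P Pr)
    (hg : Measurable g) (k : Fin K) :
    ControlledBy Pr (fun ω => ((√(S.n j))⁻¹ * ∑ i, if S.fold (S.aux ω) j i = k then
        S.ghat k ω (S.lab j i ω).2.1 - g (S.lab j i ω).2.1 - S.ghatBias (P j) g k ω else 0) ^ 2)
      (fun ω => S.ghatDist (P j) g k ω ^ 2) := by
  have h := (hS.isHeldOutFit_labErrorFit hg k).controlledBy_sq_sum_centerFit
    hsample.isIndepSample_lab (s := Finset.univ.map (.sigmaMk j)) (Q := P j)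
    (by simpa using hsample.law_lab j)
  simpa only [inv_sqrt_natCast_mul_sq, Finset.sum_map, Finset.card_map, Finset.card_univ,
    Fintype.card_fin, Function.Embedding.sigmaMk_apply, heldOutScore_centerFit_labErrorFit,
    lintegral_labErrorFit_sq] using h

lemma controlledBy_unl_sq (hS : S.IsCrossFitted) (hsample : S.IsSample P Pr) (hg : Measurable g)
    (k : Fin K) :
    ControlledBy Pr (fun ω => sampleMean fun i =>
        (S.ghat k ω (S.unl j i ω).1 - g (S.unl j i ω).1) ^ 2)
      (fun ω => S.ghatDist (P j) g k ω ^ 2) := by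
  have : IsProbabilityMeasure ((P j).map Prod.snd) :=
    Measure.isProbabilityMeasure_map measurable_snd.aemeasurable
  have h := (hS.isHeldOutFit_unlErrorFit hg k j).controlledBy_mean_sq
    (hsample.isIndepSample_unl j) (s := Finset.univ) fun i _ => hsample.law_unl j i
  simpa only [sampleMean, Finset.card_univ, Fintype.card_fin, heldOutScore_unlErrorFit,
    hS.lintegral_unlErrorFit_sq hg] using h

lemma controlledBy_sq_unl_centered (hS : S.IsCrossFitted) (hsample : S.IsSample P Pr)
    (hg : Measurable g) (k : Fin K) :
    ControlledBy Pr (fun ω => ((√(S.N j))⁻¹ * ∑ i,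
        (S.ghat k ω (S.unl j i ω).1 - g (S.unl j i ω).1 - S.ghatBias (P j) g k ω)) ^ 2)
      (fun ω => S.ghatDist (P j) g k ω ^ 2) := by
  have : IsProbabilityMeasure ((P j).map Prod.snd) :=
    Measure.isProbabilityMeasure_map measurable_snd.aemeasurable
  have h := (hS.isHeldOutFit_unlErrorFit hg k j).controlledBy_sq_sum_centerFit
    (hsample.isIndepSample_unl j) (s := Finset.univ) fun i _ => hsample.law_unl j i
  simpa only [inv_sqrt_natCast_mul_sq, Finset.card_univ, Fintype.card_fin,
    hS.heldOutScore_centerFit_unlErrorFit hg, hS.lintegral_unlErrorFit_sq hg] using h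

end IsCrossFitted

end Errors

end Run

/-! ### Convergence of the cross-fitted predictions -/

lemma tendsto_atTop_of_tendsto_div {n N : ℕ → ℕ} {ρ : ℝ} (hρ : 0 < ρ) (hN : Tendsto N atTop atTop)
    (hnN : Tendsto (fun m => (n m : ℝ) / N m) atTop (𝓝 ρ)) : Tendsto n atTop atTop := by
  rw [← tendsto_natCast_atTop_iff (R := ℝ)]
  refine (hnN.pos_mul_atTop hρ (tendsto_natCast_atTop_atTop.comp hN)).congr' ?_
  filter_upwards [hN.eventually_ne_atTop 0] with m hm
  exact div_mul_cancel₀ _ (Nat.cast_ne_zero.2 hm)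

lemma sqrt_div_mul_sqrt {x y : ℝ} (hx : 0 ≤ x) (hy : 0 < y) : √(x / y) * √y = √x := by
  rw [← Real.sqrt_mul (div_nonneg hx hy.le), div_mul_cancel₀ _ hy.ne']

namespace Run

variable {J R K p : ℕ} {𝒱 𝒰 Ω : Type*} [MeasurableSpace 𝒱]
  [MeasurableSpace Ω] {Pr : Measure Ω} {P : Fin J → Measure (Labeled 𝒱 p)} {j : Fin J}
  {S : ℕ → Run J R K p 𝒱 𝒰 Ω} {g : 𝒱 → ℝ} {ρ : ℝ}

lemma tendsto_zero_of_controlledBy_ghatDist {k : Fin K} {X : ℕ → Ω → ℝ}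
    (hd : Tendsto (fun q : ℕ × Ω => (S q.1).ghatDist (P j) g k q.2) (inProb Pr) (𝓝 0))
    (h : ∀ m, ControlledBy Pr (X m) fun ω => (S m).ghatDist (P j) g k ω ^ 2) :
    Tendsto (fun q : ℕ × Ω => X q.1 q.2) (inProb Pr) (𝓝 0) :=
  tendsto_zero_of_controlledBy h (by simpa using ENNReal.Tendsto.pow (n := 2) hd)

variable [MeasurableSpace 𝒰] [IsProbabilityMeasure (P j)]

lemma tendsto_ghatBias (hS : ∀ m, (S m).IsCrossFitted) (hg : Measurable g) {k : Fin K}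
    (hd : Tendsto (fun q : ℕ × Ω => (S q.1).ghatDist (P j) g k q.2) (inProb Pr) (𝓝 0)) :
    Tendsto (fun q : ℕ × Ω => (S q.1).ghatBias (P j) g k q.2) (inProb Pr) (𝓝 0) := by
  rw [tendsto_zero_iff_enorm_tendsto_zero]
  exact tendsto_of_tendsto_of_tendsto_of_le_of_le tendsto_const_nhds hd (fun _ => zero_le)
    fun q => (hS q.1).enorm_ghatBias_le hg

variable [IsProbabilityMeasure Pr] (hS : ∀ m, (S m).IsCrossFitted)
  (hsample : ∀ m, (S m).IsSample P Pr) (hg : Measurable g)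
  (hd : ∀ k, Tendsto (fun q : ℕ × Ω => (S q.1).ghatDist (P j) g k q.2) (inProb Pr) (𝓝 0))

include hS hsample hg hd

lemma tendsto_sqrt_mul_sampleMean_yhatLab_sub :
    Tendsto (fun q : ℕ × Ω => √((S q.1).n j) *
      (sampleMean (fun i => (S q.1).yhatLab j q.2 i - g ((S q.1).lab j i q.2).2.1) -
        sampleMean fun k => (S q.1).ghatBias (P j) g k q.2)) (inProb Pr) (𝓝 0) := by
  simp only [sqrt_mul_sampleMean_yhatLab_sub]
  rw [← Finset.sum_const_zero (s := Finset.univ (α := Fin K))]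
  refine tendsto_finsetSum _ fun k _ => ?_
  have hcentered := tendsto_zero_of_sq (tendsto_zero_of_controlledBy_ghatDist (hd k)
    fun m => (hS m).controlledBy_sq_lab_centered (hsample m) hg k)
  have hcount : Tendsto (fun q : ℕ × Ω => (√((S q.1).n j : ℝ))⁻¹ *
      ((Finset.univ.filter fun i => (S q.1).fold ((S q.1).aux q.2) j i = k).card -
        (S q.1).n j / K) * (S q.1).ghatBias (P j) g k q.2) (inProb Pr) (𝓝 0) := by
    refine squeeze_zero_norm (fun q => ?_) (by simpa using (tendsto_ghatBias hS hg (hd k)).norm)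
    rw [norm_mul]
    refine mul_le_of_le_one_left (norm_nonneg _) ?_
    rw [norm_mul, Real.norm_of_nonneg (by positivity)]
    exact mul_le_one₀ (inv_sqrt_natCast_le_one _) (norm_nonneg _)
      (abs_card_fiber_sub_div_le ((hS q.1).fold_even _ j) k)
  simpa using hcentered.add hcount

lemma tendsto_sqrt_mul_sampleMean_yhatUnl_sub (hK : 0 < K) :
    Tendsto (fun q : ℕ × Ω => √((S q.1).N j) *
      (sampleMean (fun i => (S q.1).yhatUnl j q.2 i - g ((S q.1).unl j i q.2).1) -
        sampleMean fun k => (S q.1).ghatBias (P j) g k q.2)) (inProb Pr) (𝓝 0) := by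
  simp only [sqrt_mul_sampleMean_yhatUnl_sub _ hK]
  have hcentered := fun k => tendsto_zero_of_sq (tendsto_zero_of_controlledBy_ghatDist (hd k)
    fun m => (hS m).controlledBy_sq_unl_centered (hsample m) hg k)
  exact tendsto_sampleMean_zero hcentered

lemma tendsto_sqrt_mul_sampleMean_yhat_sub (hK : 0 < K)
    (hN : Tendsto (fun m => (S m).N j) atTop atTop)
    (hnN : Tendsto (fun m => ((S m).n j : ℝ) / (S m).N j) atTop (𝓝 ρ)) :
    Tendsto (fun q : ℕ × Ω => √((S q.1).n j) *
      (sampleMean (fun i => (S q.1).yhatLab j q.2 i - g ((S q.1).lab j i q.2).2.1) -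
        sampleMean fun i => (S q.1).yhatUnl j q.2 i - g ((S q.1).unl j i q.2).1))
      (inProb Pr) (𝓝 0) := by
  have hlab := tendsto_sqrt_mul_sampleMean_yhatLab_sub hS hsample hg hd
  have hunl := (hnN.sqrt.comp tendsto_fst_inProb).mul
    (tendsto_sqrt_mul_sampleMean_yhatUnl_sub hS hsample hg hd hK)
  have h := hlab.sub hunl
  rw [mul_zero, sub_zero] at h
  refine h.congr' ?_
  filter_upwards [tendsto_fst_inProb.eventually (hN.eventually_gt_atTop 0)] with q hq
  have hNq : (0 : ℝ) < (S q.1).N j := Nat.cast_pos.2 hq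
  rw [Function.comp_apply, ← mul_assoc, sqrt_div_mul_sqrt (Nat.cast_nonneg _) hNq]
  ring

lemma meanSqClose_yhatLab : MeanSqClose (inProb Pr) (fun q => (S q.1).yhatLab j q.2)
    fun q i => g ((S q.1).lab j i q.2).2.1 := by
  simp only [MeanSqClose, yhatLab_sub_sq_eq_sum, sampleMean_sum]
  have hfold := fun k => tendsto_zero_of_controlledBy_ghatDist (hd k)
    fun m => (hS m).controlledBy_lab_sq (hsample m) hg k
  simpa using tendsto_finsetSum Finset.univ fun k _ => hfold k

lemma meanSqClose_yhatUnl (hK : 0 < K) : MeanSqClose (inProb Pr)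
    (fun q => (S q.1).yhatUnl j q.2) fun q i => g ((S q.1).unl j i q.2).1 := by
  have hmodel := fun k => tendsto_zero_of_controlledBy_ghatDist (hd k)
    fun m => (hS m).controlledBy_unl_sq (hsample m) hg k
  refine squeeze_zero (fun q => sampleMean_nonneg fun i => sq_nonneg _) (fun q => ?_)
    (tendsto_sampleMean_zero hmodel)
  rw [← sampleMean_comm]
  refine sampleMean_mono fun i => ?_
  rw [yhatUnl_sub_eq_sampleMean _ hK]
  exact sampleMean_sq_le _

end Run

/-! ### Measurability and integrability of features and estimates -/

section Features

variable {Ω 𝒱 : Type*} [MeasurableSpace Ω] [MeasurableSpace 𝒱] {p : ℕ}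

lemma continuous_feature :
    Continuous fun q : ℝ × EuclideanSpace ℝ (Fin p) => feature q.1 q.2 := by
  unfold feature
  fun_prop

lemma continuous_linPred : Continuous fun q : Coef p × Coef p => linPred q.1 q.2 := by
  unfold linPred
  fun_prop

lemma measurable_linPred_feature {b : Ω → Coef p} {yh : Ω → ℝ} {x : Ω → EuclideanSpace ℝ (Fin p)}
    (hb : Measurable b) (hyh : Measurable yh) (hx : Measurable x) :
    Measurable fun ω => linPred (b ω) (feature (yh ω) (x ω)) :=
  continuous_linPred.measurable.comp
    (hb.prodMk (continuous_feature.measurable.comp (hyh.prodMk hx)))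

lemma measurable_feature {g : 𝒱 → ℝ} (hg : Measurable g) (c : Fin (p + 2)) :
    Measurable fun w : Unlabeled 𝒱 p => feature (g w.1) w.2 c :=
  (by fun_prop : Continuous fun z : Coef p => z c).measurable.comp
    (continuous_feature.measurable.comp ((hg.comp measurable_fst).prodMk measurable_snd))

lemma measurable_fStar {g : 𝒱 → ℝ} (hg : Measurable g) (β : Coef p) : Measurable (fStar g β) :=
  measurable_linPred_feature measurable_const (hg.comp measurable_fst) measurable_snd

variable {Q : Measure Ω} [IsFiniteMeasure Q] {yh : Ω → ℝ} {x : Ω → EuclideanSpace ℝ (Fin p)}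

lemma memLp_feature (hyh : MemLp yh 2 Q) (hx : MemLp x 2 Q) (c : Fin (p + 2)) :
    MemLp (fun ω => feature (yh ω) (x ω) c) 2 Q := by
  refine Fin.cases ?_ (Fin.cases ?_ fun c => ?_) c
  · exact memLp_const 1
  · exact hyh
  · exact (EuclideanSpace.proj (𝕜 := ℝ) c).comp_memLp' hx

lemma memLp_linPred_feature (hyh : MemLp yh 2 Q) (hx : MemLp x 2 Q) (β : Coef p) :
    MemLp (fun ω => linPred β (feature (yh ω) (x ω))) 2 Q :=
  memLp_finsetSum _ fun c _ => (memLp_feature hyh hx c).const_mul (β c)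

lemma measurable_ppiPlusPlus {n N : ℕ} {y fL : Ω → Fin n → ℝ} {fU : Ω → Fin N → ℝ}
    (hy : Measurable y) (hfL : Measurable fL) (hfU : Measurable fU) :
    Measurable fun ω => ppiPlusPlus (y ω) (fL ω) (fU ω) := by
  unfold ppiPlusPlus ppiWith lambdaHat sampleCov pooledVar pooledMean sampleMean
  fun_prop

end Features

namespace Run

section Zone

variable {J R K p : ℕ} {𝒱 𝒰 Ω : Type*} [MeasurableSpace 𝒱] [MeasurableSpace 𝒰]
  [MeasurableSpace Ω] {Pr : Measure Ω} {P : Fin J → Measure (Labeled 𝒱 p)}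
  {S : Run J R K p 𝒱 𝒰 Ω}

namespace IsSample

lemma measurable_ghat (hsample : S.IsSample P Pr) (hS : S.IsCrossFitted) (k : Fin K) {v : Ω → 𝒱}
    (hv : Measurable v) : Measurable fun ω => S.ghat k ω (v ω) :=
  (hS.measurable_train k).comp
    (hsample.measurable_aux.prodMk (hsample.measurable_labData.prodMk hv))

lemma measurable_yhatLab (hsample : S.IsSample P Pr) (hS : S.IsCrossFitted) (j : Fin J)
    (i : Fin (S.n j)) : Measurable fun ω => S.yhatLab j ω i := by
  have hmodel : Measurable fun q : Fin K × Ω => S.ghat q.1 q.2 (S.lab j i q.2).2.1 :=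
    measurable_from_prod_countable_right fun k =>
      hsample.measurable_ghat hS k (hsample.measurable_lab j i).snd.fst
  exact hmodel.comp
    (((hS.measurable_fold j i).comp hsample.measurable_aux).prodMk measurable_id)

lemma measurable_yhatUnl (hsample : S.IsSample P Pr) (hS : S.IsCrossFitted) (j : Fin J)
    (i : Fin (S.N j)) : Measurable fun ω => S.yhatUnl j ω i :=
  (Finset.measurable_fun_sum _ fun k _ =>
    hsample.measurable_ghat hS k (hsample.measurable_unl j i).fst).div_const _

lemma measurable_estimate (hsample : S.IsSample P Pr) (hS : S.IsCrossFitted) {j : Fin J}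
    (hb : Measurable (S.betaHat (S.region j))) : Measurable (S.estimate j) := by
  have hy : Measurable (S.y j) :=
    measurable_pi_lambda _ fun i => (hsample.measurable_lab j i).fst
  have hfLab : Measurable (S.fLab j) := measurable_pi_lambda _ fun i =>
    measurable_linPred_feature hb (hsample.measurable_yhatLab hS j i)
      (hsample.measurable_lab j i).snd.snd
  have hfUnl : Measurable (S.fUnl j) := measurable_pi_lambda _ fun i =>
    measurable_linPred_feature hb (hsample.measurable_yhatUnl hS j i)
      (hsample.measurable_unl j i).snd
  exact measurable_ppiPlusPlus hy hfLab hfUnl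

lemma isIID_lab (hsample : S.IsSample P Pr) (j : Fin J) : IsIID Pr (P j) (S.lab j) where
  measurable := hsample.measurable_lab j
  map_eq := hsample.law_lab j
  indep := hsample.indep_lab.precomp (g := Sigma.mk j) sigma_mk_injective

lemma isIID_unl (hsample : S.IsSample P Pr) (j : Fin J) :
    IsIID Pr ((P j).map Prod.snd) (S.unl j) where
  measurable := hsample.measurable_unl j
  map_eq := hsample.law_unl j
  indep := hsample.indep_unl j

end IsSample

end Zone

end Run

/-! ### Limit theorems within a zone -/

lemma tendstoInDistribution_of_tendsto_sub_inProb {Ω : Type*} [MeasurableSpace Ω] {Pr : Measure Ω}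
    [IsProbabilityMeasure Pr] {X Y : ℕ → Ω → ℝ} {ν : Measure ℝ} [IsProbabilityMeasure ν]
    (hX : TendstoInDistribution X atTop (id : ℝ → ℝ) (fun _ => Pr) ν) (hY : ∀ m, Measurable (Y m))
    (hXY : Tendsto (fun q : ℕ × Ω => Y q.1 q.2 - X q.1 q.2) (inProb Pr) (𝓝 0)) :
    TendstoInDistribution Y atTop (id : ℝ → ℝ) (fun _ => Pr) ν := by
  have h : TendstoInMeasure Pr (Y - X) atTop fun _ => 0 := tendstoInMeasure_const_iff.2 hXY
  exact tendstoInDistribution_of_tendstoInMeasure_sub Y id hX h fun m => (hY m).aemeasurable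

lemma sqrt_mul_eq_sqrt_div_mul {n N : ℕ} (hN : N ≠ 0) (x : ℝ) :
    √(n : ℝ) * x = √((n : ℝ) / N) * (√(N : ℝ) * x) := by
  rw [← mul_assoc, sqrt_div_mul_sqrt n.cast_nonneg (by positivity)]

namespace Run

section Decomposition

variable {J R K p : ℕ} {𝒱 𝒰 Ω : Type*} [MeasurableSpace 𝒱] {P : Fin J → Measure (Labeled 𝒱 p)}
  {j : Fin J} {S : Run J R K p 𝒱 𝒰 Ω} {f : Unlabeled 𝒱 p → ℝ}

lemma sqrt_mul_oracle_sub_theta (hN : S.N j ≠ 0) (hY : Integrable (fun z => z.1) (P j))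
    (hf : Integrable (fun z => f z.2) (P j)) (l : ℝ) (ω : Ω) :
    √(S.n j) * (S.oracle f l j ω - theta (P j)) =
      √(S.n j) * (sampleMean (fun i => (S.lab j i ω).1 - l * f (S.lab j i ω).2) -
        ∫ z, (z.1 - l * f z.2) ∂(P j)) +
      l * √((S.n j : ℝ) / S.N j) * (√(S.N j) *
        (sampleMean (fun i => f (S.unl j i ω)) - ∫ z, f z.2 ∂(P j))) := by
  rw [mul_assoc, ← sqrt_mul_eq_sqrt_div_mul hN, integral_sub hY (hf.const_mul l),
    integral_const_mul, sampleMean_sub, sampleMean_const_mul]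
  have hy : S.y j ω = fun i => (S.lab j i ω).1 := rfl
  simp only [oracle, ppiWith, theta, hy]
  ring

end Decomposition

variable {J R K p : ℕ} {𝒱 𝒰 Ω : Type*} [MeasurableSpace 𝒱] [MeasurableSpace 𝒰]
  [MeasurableSpace Ω] {Pr : Measure Ω} {P : Fin J → Measure (Labeled 𝒱 p)} {j : Fin J}

lemma IsSample.indepFun_lab_unl {S : Run J R K p 𝒱 𝒰 Ω} (hsample : S.IsSample P Pr) (j : Fin J) :
    IndepFun (fun ω i => S.lab j i ω) (fun ω i => S.unl j i ω) Pr :=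
  hsample.indep_lab_unl.comp (measurable_pi_apply j) (measurable_pi_apply j)

lemma IsSample.measurable_oracle {S : Run J R K p 𝒱 𝒰 Ω} (hsample : S.IsSample P Pr)
    {f : Unlabeled 𝒱 p → ℝ} (hf : Measurable f) (l : ℝ) : Measurable (S.oracle f l j) := by
  have hlab : Measurable fun ω i => S.lab j i ω := measurable_pi_lambda _ (hsample.measurable_lab j)
  have hunl : Measurable fun ω i => S.unl j i ω := measurable_pi_lambda _ (hsample.measurable_unl j)
  exact ((measurable_sampleMean_comp measurable_fst).comp hlab).sub
    ((((measurable_sampleMean_comp (hf.comp measurable_snd)).comp hlab).sub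
      ((measurable_sampleMean_comp hf).comp hunl)).const_mul l)

variable {S : ℕ → Run J R K p 𝒱 𝒰 Ω} {ρ : ℝ} {f : Unlabeled 𝒱 p → ℝ} [IsProbabilityMeasure Pr]

lemma bddAlong_sampleMean_lab_sub_unl (hsample : ∀ m, (S m).IsSample P Pr)
    (hN : Tendsto (fun m => (S m).N j) atTop atTop)
    (hnN : Tendsto (fun m => ((S m).n j : ℝ) / (S m).N j) atTop (𝓝 ρ))
    (hf : Measurable f) (hf2 : MemLp (fun z => f z.2) 2 (P j)) :
    BddAlong (inProb Pr) fun q => √((S q.1).n j) *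
      (sampleMean (fun i => f ((S q.1).lab j i q.2).2) -
        sampleMean (fun i => f ((S q.1).unl j i q.2))) := by
  have hlab := bddAlong_sampleMean_of_isIID (fun m => (hsample m).isIID_lab j)
    (hf.comp measurable_snd) hf2
  have hunl := bddAlong_sampleMean_of_isIID (fun m => (hsample m).isIID_unl j) hf
    ((memLp_map_measure_iff hf.aestronglyMeasurable measurable_snd.aemeasurable).2 hf2)
  rw [integral_map measurable_snd.aemeasurable hf.aestronglyMeasurable] at hunl
  intro T hT
  refine (hlab.sub (hunl.mul_of_tendsto (hnN.sqrt.comp tendsto_fst_inProb)) T hT).congr' ?_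
  filter_upwards [tendsto_fst_inProb.eventually (hN.eventually_ne_atTop 0)] with q hq
  simp only [Function.comp_apply, ← sqrt_mul_eq_sqrt_div_mul hq]
  ring

variable [IsProbabilityMeasure (P j)]

lemma tendsto_sampleMean_lab (hsample : ∀ m, (S m).IsSample P Pr)
    (hn : Tendsto (fun m => (S m).n j) atTop atTop) {h : Labeled 𝒱 p → ℝ} (hh : Measurable h)
    (hint : Integrable h (P j)) :
    Tendsto (fun q : ℕ × Ω => sampleMean fun i => h ((S q.1).lab j i q.2)) (inProb Pr)
      (𝓝 (∫ z, h z ∂(P j))) := by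
  have hmean := tendsto_sampleMean_of_isIID hn (fun m => (hsample m).isIID_lab j) hh hint
  exact hmean

lemma tendsto_sampleMean_unl (hsample : ∀ m, (S m).IsSample P Pr)
    (hN : Tendsto (fun m => (S m).N j) atTop atTop) (hf : Measurable f)
    (hint : Integrable (fun z => f z.2) (P j)) :
    Tendsto (fun q : ℕ × Ω => sampleMean fun i => f ((S q.1).unl j i q.2)) (inProb Pr)
      (𝓝 (∫ z, f z.2 ∂(P j))) := by
  have : IsProbabilityMeasure ((P j).map Prod.snd) :=
    Measure.isProbabilityMeasure_map measurable_snd.aemeasurable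
  rw [← integral_map measurable_snd.aemeasurable hf.aestronglyMeasurable]
  have hmean := tendsto_sampleMean_of_isIID hN (fun m => (hsample m).isIID_unl j) hf
    ((integrable_map_measure hf.aestronglyMeasurable measurable_snd.aemeasurable).2 hint)
  exact hmean

lemma tendstoInDistribution_sampleMean_lab_add_unl (hsample : ∀ m, (S m).IsSample P Pr)
    (hn : Tendsto (fun m => (S m).n j) atTop atTop) (hN : Tendsto (fun m => (S m).N j) atTop atTop)
    {h : Labeled 𝒱 p → ℝ} (hh : Measurable h) (hh2 : MemLp h 2 (P j)) (hf : Measurable f)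
    (hf2 : MemLp (fun z => f z.2) 2 (P j)) {c : ℕ → ℝ} {d : ℝ} (hc : Tendsto c atTop (𝓝 d)) :
    TendstoInDistribution (fun m ω =>
        √((S m).n j) * (sampleMean (fun i => h ((S m).lab j i ω)) - ∫ z, h z ∂(P j)) +
        c m * (√((S m).N j) * (sampleMean (fun i => f ((S m).unl j i ω)) - ∫ z, f z.2 ∂(P j))))
      atTop (id : ℝ → ℝ) (fun _ => Pr)
      (gaussianReal 0 (variance h (P j) + d ^ 2 * varControl (P j) f).toNNReal) := by
  have : IsProbabilityMeasure ((P j).map Prod.snd) :=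
    Measure.isProbabilityMeasure_map measurable_snd.aemeasurable
  have hlab := tendstoInDistribution_sampleMean_of_isIID hn (fun m => (hsample m).isIID_lab j)
    hh hh2
  have hunl := tendstoInDistribution_sampleMean_of_isIID hN (fun m => (hsample m).isIID_unl j) hf
    ((memLp_map_measure_iff hf.aestronglyMeasurable measurable_snd.aemeasurable).2 hf2)
  rw [integral_map measurable_snd.aemeasurable hf.aestronglyMeasurable,
    variance_map hf.aemeasurable measurable_snd.aemeasurable] at hunl
  have hindep : ∀ m, IndepFun
      (fun ω => √((S m).n j) * (sampleMean (fun i => h ((S m).lab j i ω)) - ∫ z, h z ∂(P j)))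
      (fun ω => c m * (√((S m).N j) *
        (sampleMean (fun i => f ((S m).unl j i ω)) - ∫ z, f z.2 ∂(P j)))) Pr := fun m =>
    ((hsample m).indepFun_lab_unl j).comp
      (((measurable_sampleMean_comp hh).sub_const _).const_mul _)
      ((((measurable_sampleMean_comp hf).sub_const _).const_mul _).const_mul _)
  have hsum := tendstoInDistribution_gaussian_add hindep hlab
    (tendstoInDistribution_gaussian_mul hc hunl)
  rwa [← Real.toNNReal_mul (sq_nonneg d),
    ← Real.toNNReal_add (variance_nonneg _ _) (mul_nonneg (sq_nonneg d) (variance_nonneg _ _))]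
    at hsum

end Run

namespace Run

variable {J R K p : ℕ} {𝒱 𝒰 Ω : Type*} [MeasurableSpace 𝒱] [MeasurableSpace 𝒰]
  [MeasurableSpace Ω] {Pr : Measure Ω} {P : Fin J → Measure (Labeled 𝒱 p)} {j : Fin J}
  {S : ℕ → Run J R K p 𝒱 𝒰 Ω} {ρ : ℝ} {f : Unlabeled 𝒱 p → ℝ} [IsProbabilityMeasure Pr]
  [IsProbabilityMeasure (P j)]

theorem tendstoInDistribution_oracle (hsample : ∀ m, (S m).IsSample P Pr)
    (hn : Tendsto (fun m => (S m).n j) atTop atTop) (hN : Tendsto (fun m => (S m).N j) atTop atTop)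
    (hnN : Tendsto (fun m => ((S m).n j : ℝ) / (S m).N j) atTop (𝓝 ρ))
    (hY : MemLp (fun z => z.1) 2 (P j)) (hf : Measurable f)
    (hf2 : MemLp (fun z => f z.2) 2 (P j)) (l : ℝ) :
    TendstoInDistribution (fun m ω => √((S m).n j) * ((S m).oracle f l j ω - theta (P j))) atTop
      (id : ℝ → ℝ) (fun _ => Pr) (gaussianReal 0 (ρ * l ^ 2 * varControl (P j) f +
        variance (fun z => z.1 - l * f z.2) (P j)).toNNReal) := by
  have hρ : 0 ≤ ρ := ge_of_tendsto' hnN fun m => by positivity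
  have hlimit := tendstoInDistribution_sampleMean_lab_add_unl hsample hn hN
    (h := fun z => z.1 - l * f z.2) (measurable_fst.sub ((hf.comp measurable_snd).const_mul l))
    (hY.sub (hf2.const_mul l)) hf hf2 (hnN.sqrt.const_mul l)
  rw [mul_pow, Real.sq_sqrt hρ, mul_comm (l ^ 2), add_comm] at hlimit
  refine tendstoInDistribution_of_tendsto_sub_inProb hlimit
    (fun m => (((hsample m).measurable_oracle hf l).sub_const _).const_mul _) ?_
  refine tendsto_const_nhds.congr' ?_
  filter_upwards [tendsto_fst_inProb.eventually (hN.eventually_ne_atTop 0)] with q hq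
  rw [sqrt_mul_oracle_sub_theta hq (hY.integrable one_le_two) (hf2.integrable one_le_two),
    sub_self]

lemma tendsto_sampleCov_fLab (hsample : ∀ m, (S m).IsSample P Pr)
    (hn : Tendsto (fun m => (S m).n j) atTop atTop)
    (hY : MemLp (fun z => z.1) 2 (P j)) (hf : Measurable f)
    (hf2 : MemLp (fun z => f z.2) 2 (P j))
    (hfLab : MeanSqClose (inProb Pr) (fun q => (S q.1).fLab j q.2)
      fun q i => f ((S q.1).lab j i q.2).2) :
    Tendsto (fun q : ℕ × Ω => sampleCov ((S q.1).y j q.2) ((S q.1).fLab j q.2)) (inProb Pr)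
      (𝓝 (covariance (fun z => z.1) (fun z => f z.2) (P j))) := by
  have hfm : Measurable fun z : Labeled 𝒱 p => f z.2 := hf.comp measurable_snd
  have hy := tendsto_sampleMean_lab hsample hn (h := fun z => z.1) measurable_fst
    (hY.integrable one_le_two)
  have hy2 := tendsto_sampleMean_lab hsample hn (h := fun z => z.1 ^ 2) (measurable_fst.pow_const 2)
    hY.integrable_sq
  have hyf := tendsto_sampleMean_lab hsample hn (h := fun z => z.1 * f z.2) (measurable_fst.mul hfm)
    (hY.integrable_mul hf2)
  have hmean := tendsto_sampleMean_lab hsample hn hfm (hf2.integrable one_le_two)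
  have h := tendsto_sampleCov (hn.comp tendsto_fst_inProb) hy (hfLab.tendsto_sampleMean hmean)
    (hfLab.tendsto_sampleMean_mul hy2 hyf)
  rw [covariance_eq_sub hY hf2]
  exact h

lemma tendsto_pooledVar_fLab_fUnl (hsample : ∀ m, (S m).IsSample P Pr)
    (hn : Tendsto (fun m => (S m).n j) atTop atTop) (hN : Tendsto (fun m => (S m).N j) atTop atTop)
    (hf : Measurable f) (hf2 : MemLp (fun z => f z.2) 2 (P j))
    (hfLab : MeanSqClose (inProb Pr) (fun q => (S q.1).fLab j q.2)
      fun q i => f ((S q.1).lab j i q.2).2)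
    (hfUnl : MeanSqClose (inProb Pr) (fun q => (S q.1).fUnl j q.2)
      fun q i => f ((S q.1).unl j i q.2)) :
    Tendsto (fun q : ℕ × Ω => pooledVar ((S q.1).fLab j q.2) ((S q.1).fUnl j q.2)) (inProb Pr)
      (𝓝 (varControl (P j) f)) := by
  have hfm : Measurable fun z : Labeled 𝒱 p => f z.2 := hf.comp measurable_snd
  have hfi := hf2.integrable one_le_two
  have hlab := tendsto_sampleMean_lab hsample hn hfm hfi
  have hlab2 := tendsto_sampleMean_lab hsample hn (hfm.pow_const 2) hf2.integrable_sq
  have hunl := tendsto_sampleMean_unl hsample hN hf hfi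
  have hunl2 := tendsto_sampleMean_unl hsample hN (hf.pow_const 2) hf2.integrable_sq
  rw [varControl, variance_eq_sub hf2]
  exact tendsto_pooledVar (hn.comp tendsto_fst_inProb) (hfLab.tendsto_sampleMean hlab)
    (hfLab.tendsto_sampleMean_sq hlab2) (hfUnl.tendsto_sampleMean hunl)
    (hfUnl.tendsto_sampleMean_sq hunl2)

theorem tendsto_lambda (hsample : ∀ m, (S m).IsSample P Pr)
    (hn : Tendsto (fun m => (S m).n j) atTop atTop) (hN : Tendsto (fun m => (S m).N j) atTop atTop)
    (hnN : Tendsto (fun m => ((S m).n j : ℝ) / (S m).N j) atTop (𝓝 ρ))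
    (hY : MemLp (fun z => z.1) 2 (P j)) (hf : Measurable f)
    (hf2 : MemLp (fun z => f z.2) 2 (P j)) (hvar : varControl (P j) f ≠ 0)
    (hfLab : MeanSqClose (inProb Pr) (fun q => (S q.1).fLab j q.2)
      fun q i => f ((S q.1).lab j i q.2).2)
    (hfUnl : MeanSqClose (inProb Pr) (fun q => (S q.1).fUnl j q.2)
      fun q i => f ((S q.1).unl j i q.2)) :
    Tendsto (fun q : ℕ × Ω => (S q.1).lambda j q.2) (inProb Pr) (𝓝 (lambdaStar (P j) f ρ)) :=
  tendsto_lambdaHat (ge_of_tendsto' hnN fun m => by positivity) (hN.comp tendsto_fst_inProb)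
    (hnN.comp tendsto_fst_inProb) (tendsto_sampleCov_fLab hsample hn hY hf hf2 hfLab)
    (tendsto_pooledVar_fLab_fUnl hsample hn hN hf hf2 hfLab hfUnl) hvar

end Run

/-! ### The learned control function and the oracle -/

namespace Run

section Learned

variable {J R K p : ℕ} {𝒱 𝒰 Ω : Type*} [MeasurableSpace 𝒱] [MeasurableSpace 𝒰]
  [MeasurableSpace Ω] {Pr : Measure Ω} [IsProbabilityMeasure Pr]
  {P : Fin J → Measure (Labeled 𝒱 p)} {j : Fin J} [IsProbabilityMeasure (P j)]
  {S : ℕ → Run J R K p 𝒱 𝒰 Ω} {g : 𝒱 → ℝ} {β : Coef p} {ρ : ℝ}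
  (hS : ∀ m, (S m).IsCrossFitted) (hsample : ∀ m, (S m).IsSample P Pr) (hg : Measurable g)
  (hg2 : MemLp (fun z => g z.2.1) 2 (P j)) (hX : MemLp (fun z => z.2.2) 2 (P j))
  (hd : ∀ k, Tendsto (fun q : ℕ × Ω => (S q.1).ghatDist (P j) g k q.2) (inProb Pr) (𝓝 0))
  (hb : Tendsto (fun q : ℕ × Ω => (S q.1).betaHat ((S q.1).region j) q.2) (inProb Pr) (𝓝 β))

include hS hsample hg hg2 hX hd hb

lemma meanSqClose_fLab (hn : Tendsto (fun m => (S m).n j) atTop atTop) :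
    MeanSqClose (inProb Pr) (fun q => (S q.1).fLab j q.2)
      fun q i => fStar g β ((S q.1).lab j i q.2).2 := by
  have hfeature := fun c => tendsto_sampleMean_lab hsample hn
    (((measurable_feature hg c).comp measurable_snd).pow_const 2)
    (memLp_feature hg2 hX c).integrable_sq
  exact meanSqClose_linPred hb hfeature (meanSqClose_yhatLab hS hsample hg hd)

lemma meanSqClose_fUnl (hK : 0 < K) (hN : Tendsto (fun m => (S m).N j) atTop atTop) :
    MeanSqClose (inProb Pr) (fun q => (S q.1).fUnl j q.2)
      fun q i => fStar g β ((S q.1).unl j i q.2) := by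
  have hfeature := fun c => tendsto_sampleMean_unl hsample hN
    ((measurable_feature hg c).pow_const 2) (memLp_feature hg2 hX c).integrable_sq
  exact meanSqClose_linPred hb hfeature (meanSqClose_yhatUnl hS hsample hg hd hK)

lemma tendsto_sqrt_mul_sampleMean_fLab_sub_fUnl (hK : 0 < K)
    (hN : Tendsto (fun m => (S m).N j) atTop atTop)
    (hnN : Tendsto (fun m => ((S m).n j : ℝ) / (S m).N j) atTop (𝓝 ρ)) :
    Tendsto (fun q : ℕ × Ω => √((S q.1).n j) *
      ((sampleMean ((S q.1).fLab j q.2) - sampleMean fun i => fStar g β ((S q.1).lab j i q.2).2) -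
        (sampleMean ((S q.1).fUnl j q.2) - sampleMean fun i => fStar g β ((S q.1).unl j i q.2))))
      (inProb Pr) (𝓝 0) := by
  have hfeature := fun c => bddAlong_sampleMean_lab_sub_unl hsample hN hnN
    (measurable_feature hg c) (memLp_feature hg2 hX c)
  exact tendsto_mul_sampleMean_linPred_sub hb hfeature
    (tendsto_sqrt_mul_sampleMean_yhat_sub hS hsample hg hd hK hN hnN)

theorem tendsto_sqrt_mul_estimate_sub_oracle (hK : 0 < K)
    (hN : Tendsto (fun m => (S m).N j) atTop atTop)
    (hnN : Tendsto (fun m => ((S m).n j : ℝ) / (S m).N j) atTop (𝓝 ρ)) {l : ℝ}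
    (hl : Tendsto (fun q : ℕ × Ω => (S q.1).lambda j q.2) (inProb Pr) (𝓝 l)) :
    Tendsto (fun q : ℕ × Ω => √((S q.1).n j) *
      ((S q.1).estimate j q.2 - (S q.1).oracle (fStar g β) l j q.2)) (inProb Pr) (𝓝 0) :=
  tendsto_mul_ppiPlusPlus_sub hl
    (bddAlong_sampleMean_lab_sub_unl hsample hN hnN (measurable_fStar hg β)
      (memLp_linPred_feature hg2 hX β))
    (tendsto_sqrt_mul_sampleMean_fLab_sub_fUnl hS hsample hg hg2 hX hd hb hK hN hnN)

end Learned

end Run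

end PPI

theorem theorem1_general {J R K p : ℕ} (hK : 0 < K)
    {𝒱 𝒰 Ω : Type*} [MeasurableSpace 𝒱] [MeasurableSpace 𝒰] [MeasurableSpace Ω]
    (Pr : Measure Ω) [IsProbabilityMeasure Pr] (P : Fin J → Measure (PPI.Labeled 𝒱 p))
    (S : ℕ → PPI.Run J R K p 𝒱 𝒰 Ω) (hS : ∀ m, (S m).IsCrossFitted)
    (hsample : ∀ m, (S m).IsSample P Pr) (j : Fin J) [IsProbabilityMeasure (P j)]
    (hY : MemLp (fun z => z.1) 2 (P j)) (hX : MemLp (fun z => z.2.2) 2 (P j)) (ρ : ℝ)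
    (hn : Tendsto (fun m => (S m).n j) atTop atTop) (hN : Tendsto (fun m => (S m).N j) atTop atTop)
    (hnN : Tendsto (fun m => ((S m).n j : ℝ) / ((S m).N j : ℝ)) atTop (𝓝 ρ))
    (g : 𝒱 → ℝ) (hg : Measurable g) (hg2 : MemLp (fun z => g z.2.1) 2 (P j))
    (hghat : ∀ k, ∀ ε : ENNReal, 0 < ε →
      Tendsto (fun m => Pr {ω | ε ≤ (S m).ghatDist (P j) g k ω}) atTop (𝓝 0))
    (β : PPI.Coef p) (hbmeas : ∀ m, Measurable ((S m).betaHat ((S m).region j)))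
    (hβ : TendstoInMeasure Pr (fun m => (S m).betaHat ((S m).region j)) atTop (fun _ => β))
    (hvar : 0 < PPI.varControl (P j) (PPI.fStar g β)) :
    TendstoInDistribution
      (fun m ω => √((S m).n j : ℝ) * ((S m).estimate j ω - PPI.theta (P j))) atTop
      (id : ℝ → ℝ) (fun _ => Pr)
      (gaussianReal 0 (PPI.asympVar (P j) (PPI.fStar g β) ρ).toNNReal) ∧
    TendstoInMeasure Pr (fun m => (S m).lambda j) atTop
      (fun _ => PPI.lambdaStar (P j) (PPI.fStar g β) ρ) ∧
    TendstoInMeasure Pr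
      (fun m ω => √((S m).n j : ℝ) * ((S m).estimate j ω -
        (S m).oracle (PPI.fStar g β) (PPI.lambdaStar (P j) (PPI.fStar g β) ρ) j ω))
      atTop (fun _ => 0) := by
  have hd := fun k => PPI.tendsto_zero_inProb_iff.2 (hghat k)
  have hb := PPI.tendstoInMeasure_const_iff.1 hβ
  have hf := PPI.measurable_fStar hg β
  have hf2 := PPI.memLp_linPred_feature hg2 hX β
  have hlambda := PPI.Run.tendsto_lambda hsample hn hN hnN hY hf hf2 hvar.ne'
    (PPI.Run.meanSqClose_fLab hS hsample hg hg2 hX hd hb hn)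
    (PPI.Run.meanSqClose_fUnl hS hsample hg hg2 hX hd hb hK hN)
  have hequiv := PPI.Run.tendsto_sqrt_mul_estimate_sub_oracle hS hsample hg hg2 hX hd hb hK hN hnN
    hlambda
  have horacle := PPI.Run.tendstoInDistribution_oracle hsample hn hN hnN hY hf hf2
    (PPI.lambdaStar (P j) (PPI.fStar g β) ρ)
  refine ⟨PPI.tendstoInDistribution_of_tendsto_sub_inProb horacle
    (fun m => (((hsample m).measurable_estimate (hS m) (hbmeas m)).sub_const _).const_mul _)
    (hequiv.congr fun q => by ring), PPI.tendstoInMeasure_const_iff.2 hlambda,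
    PPI.tendstoInMeasure_const_iff.2 hequiv⟩

theorem theorem1 {J R K p : ℕ} (hK : 0 < K)
    {𝒱 𝒰 Ω : Type*} [MeasurableSpace 𝒱] [MeasurableSpace 𝒰] [MeasurableSpace Ω]
    (Pr : Measure Ω) [IsProbabilityMeasure Pr]
    -- the law of a labeled field in each zone, with square integrable `Y` and `X`
    (P : Fin J → Measure (PPI.Labeled 𝒱 p)) [∀ j, IsProbabilityMeasure (P j)]
    (hY : ∀ j, MemLp (fun z => z.1) 2 (P j))
    (hX : ∀ j, MemLp (fun z => z.2.2) 2 (P j))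
    -- a sequence of runs of the procedure with a fixed assignment of zones to study regions
    (r : Fin J → Fin R) (S : ℕ → PPI.Run J R K p 𝒱 𝒰 Ω)
    (hr : ∀ m, (S m).region = r)
    (hvalid : ∀ m, (S m).IsValid)
    (hsample : ∀ m, (S m).IsSample P Pr)
    -- growing sample sizes
    (ρ : Fin J → ℝ) (hρ : ∀ j, 0 < ρ j)
    (hN : ∀ j, Tendsto (fun m => (S m).N j) atTop atTop)
    (hnN : ∀ j, Tendsto (fun m => ((S m).n j : ℝ) / ((S m).N j : ℝ)) atTop (𝓝 (ρ j)))
    -- the photo models converge in mean square to a common square integrable `g`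
    (g : 𝒱 → ℝ) (hg : Measurable g) (hg2 : ∀ j, MemLp (fun z => g z.2.1) 2 (P j))
    (hghat : ∀ j k, ∀ ε : ENNReal, 0 < ε → Tendsto
      (fun m => Pr {ω | ε ≤ eLpNorm (fun z => (S m).ghat k ω z.2.1 - g z.2.1) 2 (P j)})
      atTop (𝓝 0))
    -- the LASSO coefficients converge in probability
    (β : Fin R → PPI.Coef p)
    (hβ : ∀ j, TendstoInMeasure Pr (fun m => (S m).betaHat (r j)) atTop (fun _ => β (r j)))
    -- any zone in which the limiting control function is not degenerate
    (j : Fin J) (hvar : 0 < PPI.varControl (P j) (PPI.fStar g (β (r j)))) :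
    -- asymptotic normality
    TendstoInDistribution
      (fun m ω => √((S m).n j : ℝ) * ((S m).estimate j ω - PPI.theta (P j))) atTop
      (id : ℝ → ℝ) (fun _ => Pr)
      (gaussianReal 0 (PPI.asympVar (P j) (PPI.fStar g (β (r j))) (ρ j)).toNNReal) ∧
    -- consistency of the coefficient
    TendstoInMeasure Pr (fun m => (S m).lambda j) atTop
      (fun _ => PPI.lambdaStar (P j) (PPI.fStar g (β (r j))) (ρ j)) ∧
    -- asymptotic equivalence with the oracle
    TendstoInMeasure Pr
      (fun m ω => √((S m).n j : ℝ) * ((S m).estimate j ω -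
        (S m).oracle (PPI.fStar g (β (r j)))
          (PPI.lambdaStar (P j) (PPI.fStar g (β (r j))) (ρ j)) j ω)) atTop (fun _ => 0) :=
  theorem1_general hK Pr P S (fun m => (hvalid m).isCrossFitted) hsample j (hY j) (hX j) (ρ j)
    (PPI.tendsto_atTop_of_tendsto_div (hρ j) (hN j) (hnN j)) (hN j) (hnN j) g hg (hg2 j) (hghat j)
    (β (r j)) (fun m => (hvalid m).measurable_betaHat _) (by simpa only [hr] using hβ j) hvar
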